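/- **Language.** Inner formulas are classical propositional formulas over $\neg,\wedge,\vee$ and a countable set of variables; a *term* is a non-empty conjunction of literals. Outer formulas are generated by $\alpha ::= \mathsf{Pr}(\phi)\mid \mathsf{Pr}(\phi)\diamond \bar c\mid \neg\alpha\mid\triangle\alpha\mid\alpha\odot\alpha\mid\alpha\oplus\alpha\mid\alpha\to\alpha$ with $\phi$ inner, $\diamond\in\{\le,<,>,\ge\}$, $c\in\mathbb{Q}\cap[0,1]$. A *model* for a finite set $\mathbf V$ of variables is a finitely additive probability measure $\mu$ on all subsets of $2^{\mathbf V}$. It gives $\mathsf{Pr}(\phi)$ the value $\mu(\|\phi\|)$, where $\|\phi\|$ is the set of $X\subseteq\mathbf V$ satisfying $\phi$ classically; $\mathsf{Pr}(\phi)\diamond\bar c$ the value $1$ if $\mu(\|\phi\|)\diamond c$ and $0$ otherwise; and it interprets the connectives as in Łukasiewicz logic with Baaz' operator: $1-x$ for $\neg$; $1$ if $x=1$ and $0$ otherwise for $\triangle$; $\max(0,x+y-1)$ for $\odot$; $\min(1,x+y)$ for $\oplus$; $\min(1,1-x+y)$ for $\to$. A finite set $\Gamma$ *consistently entails* $\delta$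 if every model for $\mathsf{Var}[\Gamma\cup\{\delta\}]$ giving value $1$ to all of $\Gamma$ gives value $1$ to $\delta$, and some model for $\mathsf{Var}[\Gamma]$ gives value $1$ to all of $\Gamma$. **Abduction.** An $\mathsf{FP}$ abduction problem is $\mathbb P=\langle\Gamma,\delta,\mathsf H,\mathcal V\rangle$ with $\Gamma$ a finite set of outer formulas, $\delta$ an outer formula, $\mathsf H$ a finite set of terms with $\mathsf{Var}[\mathsf H]\subseteq\mathsf{Var}[\Gamma\cup\{\delta\}]$, and $\mathcal V=\{0,\frac1n,\dots,\frac{n-1}n,1\}$, $n\ge1$. Let $\mathbf V=\mathsf{Var}[\mathbb P]$. A $\langle\mathbf V,\mathcal V\rangle$-*complete* probabilistic interval term is a formula $$\theta=\bigodot_{i=1}^k \mathsf{Pr}(\tau_i)\le\bar c_i\ \odot\ \bigodot_{i=1}^k \mathsf{Pr}(\tau_i)\ge\bar c_i$$ (up to order and bracketing of the conjuncts), where the $\tau_i$ are satisfiable, pairwise inequivalent terms with $\mathsf{Var}(\tau_i)=\mathbf V$, $c_i\in\mathcal V$, and $\sum_i c_i=1$. A *full solution* to $\mathbb P$ is a $\langle\mathbf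 V,\mathcal V\rangle$-complete $\theta$ such that $\Gamma\cup\{\theta\}$ consistently entails $\delta$. **Theorem.** (1) For every $\mathsf{FP}$ abduction problem $\mathbb P$ with $\mathbf V=\mathsf{Var}[\mathbb P]$ and every $\langle\mathbf V,\mathcal V\rangle$-complete $\theta$ as above, there is exactly one model for $\mathbf V$ giving $\theta$ the value $1$, and in it $\mathsf{Pr}(\phi)$ has value $\sum_{i:\,\tau_i\models\phi}c_i$ (with $\models$ classical entailment) for every inner formula $\phi$ with $\mathsf{Var}(\phi)\subseteq\mathbf V$. (2) There is a deterministic multi-tape (multi-stack) Turing machine which, given an $\mathsf{FP}$ abduction problem $\mathbb P$ and a $\langle\mathbf V,\mathcal V\rangle$-complete $\theta$, decides in time polynomial in the total length of $\mathbb P$ and $\theta$ whether $\theta$ is a full solution to $\mathbb P$. Here formulas are written as strings over a finite alphabet (in reverse Polish notation), with variable indices, the numerators and denominators of constants, and $n$ in binary. -/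

import Mathlib

namespace FPAbduction

/-! ### Language -/

/-- Classical propositional formulas over `¬, ∧, ∨`; the countable set of variables is `ℕ`. -/
inductive Inner : Type
  | var : ℕ → Inner
  | neg : Inner → Inner
  | and : Inner → Inner → Inner
  | or : Inner → Inner → Inner
  deriving DecidableEq

/-- The comparison symbols `≤, <, >, ≥`. -/
inductive Cmp : Type
  | le | lt | gt | ge
  deriving DecidableEq

instance : Fintype Cmp where
  elems := {Cmp.le, Cmp.lt, Cmp.gt, Cmp.ge}
  complete := by intro d; cases d <;> simp

/-- Truth constants: rational numbers in `[0, 1]`. -/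
abbrev Const : Type := Set.Icc (0 : ℚ) 1

/-- Outer formulas: `Pr(φ) | Pr(φ) ⋄ c | ¬α | △α | α ⊙ α | α ⊕ α | α → α`. -/
inductive Outer : Type
  | pr : Inner → Outer
  | cmp : Inner → Cmp → Const → Outer
  | neg : Outer → Outer
  | delta : Outer → Outer
  | odot : Outer → Outer → Outer
  | oplus : Outer → Outer → Outer
  | imp : Outer → Outer → Outer

/-- `Var(φ)` for inner formulas. -/
def Inner.vars : Inner → Finset ℕ
  | .var p => {p}
  | .neg φ => φ.vars
  | .and φ χ => φ.vars ∪ χ.vars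
  | .or φ χ => φ.vars ∪ χ.vars

/-- `Var(α)` for outer formulas. -/
def Outer.vars : Outer → Finset ℕ
  | .pr φ => φ.vars
  | .cmp φ _ _ => φ.vars
  | .neg α => α.vars
  | .delta α => α.vars
  | .odot α β => α.vars ∪ β.vars
  | .oplus α β => α.vars ∪ β.vars
  | .imp α β => α.vars ∪ β.vars

/-- `Var[Φ]` for a finite set of inner formulas, given as a list. -/
def innerVars : List Inner → Finset ℕ
  | [] => ∅
  | φ :: Φ => φ.vars ∪ innerVars Φ

/-- `Var[Γ]` for a finite set of outer formulas, given as a list. -/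
def outerVars : List Outer → Finset ℕ
  | [] => ∅
  | α :: Γ => α.vars ∪ outerVars Γ

/-! ### Semantics -/

/-- The states of a model for `V`: the subsets of `V`. -/
abbrev State (V : Finset ℕ) : Type := {X : Finset ℕ // X ⊆ V}

/-- Probabilistic models for `V`: a finitely additive probability measure on all sets of states. -/
structure Model (V : Finset ℕ) where
  μ : Set (State V) → ℝ
  mem_Icc : ∀ A, μ A ∈ Set.Icc (0 : ℝ) 1
  univ : μ Set.univ = 1
  empty : μ ∅ = 0
  union : ∀ A B, A ∩ B = ∅ → μ (A ∪ B) = μ A + μ B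

/-- The truth set `‖φ‖` (meaningful when `Var(φ) ⊆ V`). -/
def truthSet (V : Finset ℕ) : Inner → Set (State V)
  | .var p => {X | p ∈ X.1}
  | .neg φ => (truthSet V φ)ᶜ
  | .and φ χ => truthSet V φ ∩ truthSet V χ
  | .or φ χ => truthSet V φ ∪ truthSet V χ

/-- `x ⋄ y` on the reals. -/
def Cmp.Holds : Cmp → ℝ → ℝ → Prop
  | .le, x, y => x ≤ y
  | .lt, x, y => x < y
  | .gt, x, y => x > y
  | .ge, x, y => x ≥ y

open scoped Classical in
/-- The interpretation of outer formulas induced by a model. -/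
noncomputable def Model.value {V : Finset ℕ} (M : Model V) : Outer → ℝ
  | .pr φ => M.μ (truthSet V φ)
  | .cmp φ d c => if d.Holds (M.μ (truthSet V φ)) ((c : ℚ) : ℝ) then 1 else 0
  | .neg α => 1 - M.value α
  | .delta α => if M.value α = 1 then 1 else 0
  | .odot α β => max 0 (M.value α + M.value β - 1)
  | .oplus α β => min 1 (M.value α + M.value β)
  | .imp α β => min 1 (1 - M.value α + M.value β)

/-- `Γ ⊨ δ`. -/
def Entails (Γ : List Outer) (δ : Outer) : Prop :=
  ∀ M : Model (outerVars (δ :: Γ)), (∀ γ ∈ Γ, M.value γ = 1) → M.value δ = 1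

/-- `Γ ⊨ ⊥`: as `⊥` has value `0` in every model, this says that no model for `Var[Γ]` gives
value `1` to all members of `Γ`. -/
def EntailsFalsum (Γ : List Outer) : Prop :=
  ∀ M : Model (outerVars Γ), ¬ ∀ γ ∈ Γ, M.value γ = 1

/-- Consistent entailment. -/
def ConsEntails (Γ : List Outer) (δ : Outer) : Prop :=
  Entails Γ δ ∧ ¬ EntailsFalsum Γ

/-! ### Terms, abduction problems, full solutions -/

/-- Propositional literals. -/
def Inner.IsLiteral : Inner → Prop
  | .var _ => True
  | .neg (.var _) => True
  | _ => False

/-- Propositional terms: non-empty conjunctions of literals (arbitrarily bracketed). -/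
def Inner.IsTerm : Inner → Prop
  | .and φ χ => φ.IsTerm ∧ χ.IsTerm
  | φ => φ.IsLiteral

/-- The set of values `{0, 1/n, …, (n-1)/n, 1}` (for `n ≥ 1`). -/
def values (n : ℕ) : Set ℚ := {c | ∃ i : ℕ, i ≤ n ∧ c = (i : ℚ) / (n : ℚ)}

/-- Abduction problems `⟨Γ, δ, H, {0, 1/n, …, 1}⟩`; the finite sets `Γ` and `H` are given as lists
of their members. -/
structure Problem where
  theory : List Outer
  observation : Outer
  hypotheses : List Inner
  n : ℕ
  n_pos : 1 ≤ n
  isTerm_of_mem : ∀ τ ∈ hypotheses, τ.IsTerm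
  vars_subset : innerVars hypotheses ⊆ outerVars (observation :: theory)

/-- `Var[ℙ]`. -/
def Problem.vars (P : Problem) : Finset ℕ :=
  outerVars (P.observation :: P.theory) ∪ innerVars P.hypotheses

/-- The members `λ₁, …, λₙ` of a `⊙`-conjunction `λ₁ ⊙ … ⊙ λₙ` (arbitrarily bracketed). -/
def Outer.conjuncts : Outer → List Outer
  | .odot α β => α.conjuncts ++ β.conjuncts
  | α => [α]

/-- `θ` is the `⟨V, {0, 1/n, …, 1}⟩`-complete probabilistic interval term
`⨀ᵢ Pr(τᵢ) ≤ cᵢ ⊙ ⨀ᵢ Pr(τᵢ) ≥ cᵢ` (up to order and bracketing of the conjuncts), where `L` lists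
the pairs `(τᵢ, cᵢ)`. Every `τᵢ` is a consistent term over exactly the variables `V`, so it describes
one state; different indices describe different states. -/
structure IsCompleteWith (V : Finset ℕ) (n : ℕ) (L : List (Inner × Const)) (θ : Outer) :
    Prop where
  conjuncts_perm : θ.conjuncts.Perm
    (L.map (fun q => Outer.cmp q.1 Cmp.le q.2) ++ L.map (fun q => Outer.cmp q.1 Cmp.ge q.2))
  isTerm : ∀ q ∈ L, q.1.IsTerm
  vars_eq : ∀ q ∈ L, q.1.vars = V
  satisfiable : ∀ q ∈ L, (truthSet V q.1).Nonempty
  inequivalent : L.Pairwise (fun q r => truthSet V q.1 ≠ truthSet V r.1)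
  mem_values : ∀ q ∈ L, (q.2 : ℚ) ∈ values n
  sum_eq_one : (L.map (fun q => (q.2 : ℚ))).sum = 1

open scoped Classical in
/-- The sum of the `cᵢ` over all `i` such that `τᵢ` classically entails `φ` (over the variables
`V`). -/
noncomputable def sumEntailing (V : Finset ℕ) (L : List (Inner × Const)) (φ : Inner) : ℝ :=
  (L.map (fun q => if truthSet V q.1 ⊆ truthSet V φ then ((q.2 : ℚ) : ℝ) else 0)).sum

/-- `⟨V, {0, 1/n, …, 1}⟩`-complete probabilistic interval terms. -/
def IsComplete (V : Finset ℕ) (n : ℕ) (θ : Outer) : Prop :=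
  ∃ L : List (Inner × Const), IsCompleteWith V n L θ

/-- `θ` is a full solution to `P`. -/
def IsFullSolution (P : Problem) (θ : Outer) : Prop :=
  IsComplete P.vars P.n θ ∧ ConsEntails (θ :: P.theory) P.observation

/-! ### The recognition problem and its inputs as strings -/

/-- The inputs: a problem together with a complete probabilistic interval term. -/
structure Input where
  problem : Problem
  candidate : Outer
  complete : IsComplete problem.vars problem.n candidate

/-- The finite input alphabet. -/
inductive Letter : Type
  | bit : Bool → Letter
  | var | close | slash | comma | hash
  | ineg | iand | ior
  | pr
  | cmp : Cmp → Letter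
  | neg | delta | odot | oplus | imp
  deriving DecidableEq, Fintype

/-- Binary digits, least significant first. -/
def binary (n : ℕ) : List Letter := n.bits.map Letter.bit

/-- Inner formulas in reverse Polish notation, with binary variable indices. -/
def Inner.encode : Inner → List Letter
  | .var p => Letter.var :: binary p ++ [Letter.close]
  | .neg φ => φ.encode ++ [Letter.ineg]
  | .and φ χ => φ.encode ++ χ.encode ++ [Letter.iand]
  | .or φ χ => φ.encode ++ χ.encode ++ [Letter.ior]

/-- Rational constants: numerator and denominator (in lowest terms) in binary. -/
def encodeConst (c : Const) : List Letter :=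
  binary (c : ℚ).num.toNat ++ [Letter.slash] ++ binary (c : ℚ).den ++ [Letter.close]

/-- Outer formulas in reverse Polish notation. -/
def Outer.encode : Outer → List Letter
  | .pr φ => φ.encode ++ [Letter.pr]
  | .cmp φ d c => φ.encode ++ [Letter.cmp d] ++ encodeConst c
  | .neg α => α.encode ++ [Letter.neg]
  | .delta α => α.encode ++ [Letter.delta]
  | .odot α β => α.encode ++ β.encode ++ [Letter.odot]
  | .oplus α β => α.encode ++ β.encode ++ [Letter.oplus]
  | .imp α β => α.encode ++ β.encode ++ [Letter.imp]

/-- Problems: `Γ # δ # H # n #`, with the members of `Γ` and `H` each followed by a comma, and with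
`n` (which determines the set of values) in binary. -/
def Problem.encode (P : Problem) : List Letter :=
  P.theory.flatMap (fun γ => γ.encode ++ [Letter.comma]) ++ [Letter.hash] ++
    P.observation.encode ++ [Letter.hash] ++
    P.hypotheses.flatMap (fun τ => τ.encode ++ [Letter.comma]) ++ [Letter.hash] ++
    binary P.n ++ [Letter.hash]

/-- The string presented to the machine; its length is the size of the input. -/
def Input.encode (I : Input) : List Letter :=
  I.problem.encode ++ I.candidate.encode

open scoped Classical in
/-- The answer to be computed: is the candidate a full solution? -/
noncomputable def Input.answer (I : Input) : Bool :=
  decide (IsFullSolution I.problem I.candidate)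

end FPAbduction

/-!
Part (1). A satisfiable term over all variables describes a single state, and inequivalent ones
describe different states (`subsingleton_truthSet`). A model gives `θ` the value `1` exactly if it
gives the states described by the `τᵢ` the weights `cᵢ`. As the weights sum up to `1`, finite
additivity applied to a set and to its complement leaves only one possibility for the measure of the
set, the sum of the weights of the described states in it (`IsCompleteWith.eq_model`), and this
does define a model (`IsCompleteWith.model`).

Part (2). By the first part, `θ` is a full solution if and only if its model gives the theory and
the observation the value `1` (`isFullSolution_iff`), and this is a matter of evaluation. The
probability of an inner formula is computed as a fraction by going through the conjuncts
`Pr(τᵢ) ≤ pᵢ / qᵢ` of `θ`, evaluating the formula under the assignment that `τᵢ` describes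
(`mass`). Every fraction obtained in this way has the product `D` of the `qᵢ` as its denominator, so
all values of outer formulas are represented by their numerators over `D`, and the connectives become
additions and truncated subtractions (`outerStep`, `exists_outerScan`). Formulas in reverse Polish
notation are evaluated in one pass with a stack.

The Turing machine is obtained in three layers. Structured programs on three stacks are compiled to
`Turing.TM2` machines, step for step (`Exec.code`). On top of them, `Feasible f g` says that one
program transforms the list of strings `f i` into the list of strings `g i` for all `i` in polynomial
time. Feasible transformations compose, they may be applied below the top string of a list, and they
may be iterated over the letters of a string as long as the intermediate results have polynomial
size (`Feasible.trans`, `Feasible.dip`, `Feasible.foldl`). With such rules the bit string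
arithmetic and the evaluation of formulas are assembled, each function being defined as a fold over
its input. Since `Letter.hash` serves as the end marker of strings, an input word already is a list
of strings, with one end marker missing (`Input.encode_eq`, `Feasible.computableInPolyTime`).
-/

namespace FPAbduction

/-! ### Programs on three stacks and their compilation to stack Turing machines -/

/-- The work stacks: a data stack, a control stack holding postponed data, and an auxiliary one. -/
inductive Stk : Type
  | main | ctrl | aux
  deriving DecidableEq

instance : Fintype Stk where
  elems := {Stk.main, Stk.ctrl, Stk.aux}
  complete := by intro k; cases k <;> simp

/-- Structured programs on the work stacks. Stack symbols are `some a` with `a : A`, and the end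
marker `none`; popping an empty stack counts as popping an end marker. `pop k f` pops a symbol from
`k` and continues with the program that `f` assigns to it; `loop k f` pops symbols from `k` and runs
`f` on them, until an end marker has been popped. -/
inductive Prog (A : Type) : Type
  | skip : Prog A
  | push : Stk → Option A → Prog A
  | pop : Stk → (Option A → Prog A) → Prog A
  | seq : Prog A → Prog A → Prog A
  | loop : Stk → (A → Prog A) → Prog A

/-- Contents of the work stacks. -/
abbrev Store (A : Type) : Type := Stk → List (Option A)

section Machine

variable {A : Type}

/-- `Exec c S S' t`: the program `c` transforms `S` into `S'`, in time `t`. -/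
inductive Exec : Prog A → Store A → Store A → ℕ → Prop
  | skip (S : Store A) : Exec .skip S S 1
  | push (k : Stk) (a : Option A) (S : Store A) :
      Exec (.push k a) S (Function.update S k (a :: S k)) 1
  | pop {k : Stk} {f : Option A → Prog A} {S S' : Store A} {t : ℕ} :
      Exec (f (S k).head?.join) (Function.update S k (S k).tail) S' t → Exec (.pop k f) S S' (t + 1)
  | seq {c d : Prog A} {S S' S'' : Store A} {t u : ℕ} :
      Exec c S S' t → Exec d S' S'' u → Exec (.seq c d) S S'' (t + u)
  | loop_done {k : Stk} {f : A → Prog A} {S : Store A} :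
      (S k).head?.join = none → Exec (.loop k f) S (Function.update S k (S k).tail) 1
  | loop_step {k : Stk} {f : A → Prog A} {S S' S'' : Store A} {a : A} {t u : ℕ} :
      (S k).head?.join = some a → Exec (f a) (Function.update S k (S k).tail) S' t →
      Exec (.loop k f) S' S'' u → Exec (.loop k f) S S'' (u + (t + 1))

/-- The number of symbols on the work stacks. -/
def Store.total (S : Store A) : ℕ :=
  (S .main).length + (S .ctrl).length + (S .aux).length

theorem Store.total_push (S : Store A) (k : Stk) (a : Option A) :
    Store.total (Function.update S k (a :: S k)) = S.total + 1 := by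
  cases k <;> simp [Store.total, Function.update] <;> omega

theorem Store.total_tail (S : Store A) (k : Stk) :
    Store.total (Function.update S k (S k).tail) ≤ S.total := by
  cases k <;> simp [Store.total, Function.update]

/-- One unit of time adds at most one symbol. -/
theorem Exec.total_le {c : Prog A} {S S' : Store A} {t : ℕ} (h : Exec c S S' t) :
    S'.total ≤ S.total + t := by
  induction h with
  | skip S => simp
  | push k a S => rw [Store.total_push]
  | @pop k f S S' t h ih => have := Store.total_tail S k; omega
  | seq h₁ h₂ ih₁ ih₂ => omega
  | @loop_done k f S h => have := Store.total_tail S k; omega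
  | @loop_step k f S S' S'' a t u h h₁ h₂ ih₁ ih₂ => have := Store.total_tail S k; omega

/-- The stack alphabets of the machine: the output stack is indexed by `none`. -/
abbrev StackAlphabet (A : Type) : Option Stk → Type
  | none => Bool
  | some _ => Option A

/-- Statements of the machine; its internal state is the symbol popped last. -/
abbrev MachineStmt (A Λ : Type) : Type := Turing.TM2.Stmt (StackAlphabet A) Λ (Option A)

/-- The program points of a program. -/
def Prog.Label : Prog A → Type
  | .skip => Unit
  | .push _ _ => Unit
  | .pop _ f => Option (Σ o, (f o).Label)
  | .seq c d => c.Label ⊕ d.Label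
  | .loop _ f => Option (Σ a, (f a).Label)

/-- A program has finitely many program points. -/
@[reducible] noncomputable def Prog.fintypeLabel [Fintype A] : ∀ c : Prog A, Fintype c.Label
  | .skip => inferInstanceAs (Fintype Unit)
  | .push _ _ => inferInstanceAs (Fintype Unit)
  | .pop _ f =>
    letI := fun o => (f o).fintypeLabel
    inferInstanceAs (Fintype (Option (Σ o, (f o).Label)))
  | .seq c d =>
    letI := c.fintypeLabel
    letI := d.fintypeLabel
    inferInstanceAs (Fintype (c.Label ⊕ d.Label))
  | .loop _ f =>
    letI := fun a => (f a).fintypeLabel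
    inferInstanceAs (Fintype (Option (Σ a, (f a).Label)))

/-- The program point where execution starts. -/
def Prog.entry : ∀ c : Prog A, c.Label
  | .skip => ()
  | .push _ _ => ()
  | .pop _ _ => (none : Option _)
  | .seq c _ => Sum.inl c.entry
  | .loop _ _ => (none : Option _)

/-- The machine code of a program: `e` embeds its program points into the labels of the machine,
and `x` is the statement to be executed at the end. -/
def Prog.code {Λ : Type} : ∀ c : Prog A, (c.Label → Λ) → MachineStmt A Λ → c.Label → MachineStmt A Λ
  | .skip, _, x, _ => x
  | .push k a, _, x, _ => .push (some k) (fun _ => a) x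
  | .pop k f, e, _, none =>
    .pop (some k) (fun _ o => o.join) (.goto fun v => e (some ⟨v, (f v).entry⟩))
  | .pop _ f, e, x, some ⟨o, l⟩ => (f o).code (fun l => e (some ⟨o, l⟩)) x l
  | .seq c d, e, _, Sum.inl l =>
    c.code (fun l => e (Sum.inl l)) (.goto fun _ => e (Sum.inr d.entry)) l
  | .seq _ d, e, x, Sum.inr l => d.code (fun l => e (Sum.inr l)) x l
  | .loop k f, e, x, none =>
    .pop (some k) (fun _ o => o.join) (.branch (fun v => v.isSome)
      (.goto fun v => v.elim (e none) fun a => e (some ⟨a, (f a).entry⟩)) x)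
  | .loop _ f, e, _, some ⟨a, l⟩ =>
    (f a).code (fun l => e (some ⟨a, l⟩)) (.goto fun _ => e none) l

/-- The stacks of the machine, given the work stacks and the output stack. -/
def Store.lift (S : Store A) (O : List Bool) : ∀ k, List (StackAlphabet A k)
  | none => O
  | some k => S k

theorem Store.update_lift (S : Store A) (O : List Bool) (k : Stk) (l : List (Option A)) :
    Function.update (S.lift O) (some k) l = Store.lift (Function.update S k l) O := by
  funext j
  rcases j with _ | j
  · rfl
  · by_cases h : j = k
    · subst h; simp [Store.lift]
    · simp [Store.lift, h]

/-- A bind-iterate absorbs a successful first step. -/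
theorem iterate_flip_bind_succ {α : Type} {f : α → Option α} {a b : α} (h : f a = some b) (n : ℕ) :
    (flip bind f)^[n + 1] (some a) = (flip bind f)^[n] (some b) := by
  rw [Function.iterate_succ_apply]
  exact congrArg _ h

theorem step_of_eq {Λ : Type} {M : Λ → MachineStmt A Λ} {l : Λ} {q : MachineStmt A Λ} (h : M l = q)
    (v : Option A) (S : ∀ k, List (StackAlphabet A k)) :
    Turing.TM2.step M ⟨some l, v, S⟩ = some (Turing.TM2.stepAux q v S) := by
  rw [← h]; rfl

theorem stepAux_push_lift {Λ : Type} (q : MachineStmt A Λ) (k : Stk) (a : Option A) (v : Option A)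
    (S : Store A) (O : List Bool) :
    Turing.TM2.stepAux (.push (some k) (fun _ => a) q) v (S.lift O) =
      Turing.TM2.stepAux q v (Store.lift (Function.update S k (a :: S k)) O) := by
  rw [← Store.update_lift]; rfl

theorem stepAux_pop_lift {Λ : Type} (q : MachineStmt A Λ) (k : Stk) (v : Option A)
    (S : Store A) (O : List Bool) :
    Turing.TM2.stepAux (.pop (some k) (fun _ o => o.join) q) v (S.lift O) =
      Turing.TM2.stepAux q (S k).head?.join
        (Store.lift (Function.update S k (S k).tail) O) := by
  rw [← Store.update_lift]; rfl

/-- The machine code of `c` does what `c` does, and then executes `x`; the time is the number of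
machine steps, the last of which executes `x`. -/
theorem Exec.code {c : Prog A} {S S' : Store A} {t : ℕ} (h : Exec c S S' t) {Λ : Type}
    (M : Λ → MachineStmt A Λ) (e : c.Label → Λ) (x : MachineStmt A Λ)
    (hM : ∀ l, M (e l) = c.code e x l) (v : Option A) (O : List Bool) :
    ∃ v', (flip bind (Turing.TM2.step M))^[t] (some ⟨some (e c.entry), v, S.lift O⟩) =
      some (Turing.TM2.stepAux x v' (S'.lift O)) := by
  induction h generalizing Λ v with
  | skip S => exact ⟨v, step_of_eq (hM ()) v _⟩
  | push k a S =>
    exact ⟨v, (step_of_eq (hM ()) v _).trans (congrArg some (stepAux_push_lift _ _ _ _ _ _))⟩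
  | @pop k f S S' t h ih =>
    obtain ⟨v', hv⟩ := ih M (fun l => e (some ⟨_, l⟩)) x (fun l => hM (some ⟨_, l⟩))
      (S k).head?.join
    refine ⟨v', (iterate_flip_bind_succ ?_ _).trans hv⟩
    exact (step_of_eq (hM none) v _).trans (congrArg some (stepAux_pop_lift _ _ _ _ _))
  | @seq c d S S' S'' t u h₁ h₂ ih₁ ih₂ =>
    obtain ⟨v₁, hv₁⟩ := ih₁ M (fun l => e (Sum.inl l)) (.goto fun _ => e (Sum.inr d.entry))
      (fun l => hM (Sum.inl l)) v
    obtain ⟨v₂, hv₂⟩ := ih₂ M (fun l => e (Sum.inr l)) x (fun l => hM (Sum.inr l)) v₁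
    refine ⟨v₂, ?_⟩
    rw [add_comm, Function.iterate_add_apply]
    exact (congrArg _ hv₁).trans hv₂
  | @loop_done k f S h =>
    refine ⟨none, (step_of_eq (hM none) v _).trans (congrArg some ?_)⟩
    refine (stepAux_pop_lift _ _ _ _ _).trans ?_
    rw [h]
    rfl
  | @loop_step k f S S' S'' a t u h h₁ h₂ ih₁ ih₂ =>
    obtain ⟨v₁, hv₁⟩ := ih₁ M (fun l => e (some ⟨a, l⟩)) (.goto fun _ => e none)
      (fun l => hM (some ⟨a, l⟩)) (some a)
    obtain ⟨v₂, hv₂⟩ := ih₂ M e x hM v₁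
    refine ⟨v₂, ?_⟩
    rw [Function.iterate_add_apply]
    refine (congrArg _ ((iterate_flip_bind_succ ?_ _).trans hv₁)).trans hv₂
    refine (step_of_eq (hM none) v _).trans (congrArg some ?_)
    refine (stepAux_pop_lift _ _ _ _ _).trans ?_
    rw [h]
    rfl

end Machine

/-! ### Polynomial-time transformations of lists of strings -/

section Feasible

variable {A : Type}

/-- The store with the given contents of the three work stacks. -/
def store (m c a : List (Option A)) : Store A
  | .main => m
  | .ctrl => c
  | .aux => a

@[simp] theorem store_main (m c a : List (Option A)) : store m c a .main = m := rfl
@[simp] theorem store_ctrl (m c a : List (Option A)) : store m c a .ctrl = c := rfl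
@[simp] theorem store_aux (m c a : List (Option A)) : store m c a .aux = a := rfl

@[simp] theorem update_store_main (m c a x : List (Option A)) :
    Function.update (store m c a) .main x = store x c a := by
  funext k; cases k <;> simp [Function.update]

@[simp] theorem update_store_ctrl (m c a x : List (Option A)) :
    Function.update (store m c a) .ctrl x = store m x a := by
  funext k; cases k <;> simp [Function.update]

@[simp] theorem update_store_aux (m c a x : List (Option A)) :
    Function.update (store m c a) .aux x = store m c x := by
  funext k; cases k <;> simp [Function.update]

/-- The stack contents `m` with the string `s`, closed by an end marker, on top. -/
def onTop (s : List A) (m : List (Option A)) : List (Option A) := s.map some ++ none :: m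

@[simp] theorem onTop_nil (m : List (Option A)) : onTop [] m = none :: m := rfl
@[simp] theorem onTop_cons (a : A) (s : List A) (m : List (Option A)) :
    onTop (a :: s) m = some a :: onTop s m := rfl
@[simp] theorem length_onTop (s : List A) (m : List (Option A)) :
    (onTop s m).length = s.length + 1 + m.length := by
  simp [onTop]; omega

/-- A list of strings as the contents of a stack. -/
def flat : List (List A) → List (Option A)
  | [] => []
  | s :: e => onTop s (flat e)

/-- The number of stack cells taken by a list of strings. -/
def size : List (List A) → ℕ
  | [] => 0
  | s :: e => s.length + 1 + size e

@[simp] theorem size_nil : size ([] : List (List A)) = 0 := rfl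
@[simp] theorem size_cons (s : List A) (e : List (List A)) :
    size (s :: e) = s.length + 1 + size e := rfl

theorem length_flat (e : List (List A)) : (flat e).length = size e := by
  induction e with
  | nil => rfl
  | cons s e ih => simp [flat, ih]

/-- The top string of the stack contents `l` is `s`, and `m` is what remains when it is removed. The end
marker may be missing if `s` lies at the bottom. -/
def IsTop (l : List (Option A)) (s : List A) (m : List (Option A)) : Prop :=
  l = onTop s m ∨ l = s.map some ∧ m = []

theorem isTop_onTop (s : List A) (m : List (Option A)) : IsTop (onTop s m) s m := Or.inl rfl

theorem IsTop.nil {l m : List (Option A)} (h : IsTop l [] m) :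
    l.head?.join = none ∧ l.tail = m := by
  rcases h with rfl | ⟨rfl, rfl⟩ <;> simp

theorem IsTop.cons {l m : List (Option A)} {a : A} {s : List A} (h : IsTop l (a :: s) m) :
    l.head? = some (some a) ∧ IsTop l.tail s m := by
  rcases h with rfl | ⟨rfl, rfl⟩
  · exact ⟨rfl, Or.inl rfl⟩
  · exact ⟨rfl, Or.inr ⟨rfl, rfl⟩⟩

/-- Move the top string of `k` to `l`, reversing it. -/
def Prog.move (k l : Stk) : Prog A :=
  .seq (.push l none) (.loop k fun a => .push l (some a))

/-- Equal stores may be substituted in executions. -/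
theorem Exec.congr {c : Prog A} {S S' T : Store A} {t u : ℕ} (h : Exec c S S' t) (hS : S' = T)
    (ht : t = u) : Exec c S T u := hS ▸ ht ▸ h

/-- The loop that pushes onto `l` what it pops from `k` moves the top string of `k`, reversed. -/
theorem exec_loop_push {k l : Stk} (hkl : k ≠ l) (s : List A) (m : List (Option A)) (S : Store A)
    (h : IsTop (S k) s m) :
    Exec (.loop k fun a => .push l (some a)) S
      (Function.update (Function.update S k m) l (s.reverse.map some ++ S l))
      (2 * s.length + 1) := by
  induction s generalizing S with
  | nil =>
    obtain ⟨h₁, rfl⟩ := h.nil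
    have := Exec.loop_done (f := fun a => Prog.push l (some a)) h₁
    have hs : Function.update (Function.update S k (S k).tail) l
        ((([] : List A).reverse.map some) ++ S l) = Function.update S k (S k).tail := by
      funext j
      by_cases hj : j = l
      · subst hj; simp [hkl.symm]
      · simp [hj]
    rw [hs]
    exact this
  | cons a s ih =>
    obtain ⟨h₁, h₂⟩ := h.cons
    refine (Exec.loop_step (f := fun a => Prog.push l (some a)) (a := a) (by rw [h₁]; rfl)
      (Exec.push l (some a) _) (ih _ (by simpa [hkl] using h₂))).congr ?_ (by simp; ring)
    funext j
    by_cases hj : j = l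
    · subst hj; simp [hkl.symm]
    · by_cases hj' : j = k
      · subst hj'; simp [hkl]
      · simp [hj, hj']

theorem exec_move {k l : Stk} (hkl : k ≠ l) (s : List A) (m : List (Option A)) (S : Store A)
    (h : IsTop (S k) s m) :
    Exec (.move k l) S (Function.update (Function.update S k m) l (onTop s.reverse (S l)))
      (2 * s.length + 2) := by
  refine (Exec.seq (Exec.push l none S) (exec_loop_push hkl s m _ (by simpa [hkl] using h))).congr
    ?_ (by ring)
  funext j
  by_cases hj : j = l
  · subst hj; simp [onTop]
  · by_cases hj' : j = k
    · subst hj'; simp [hkl]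
    · simp [hj, hj']

/-- `Feasible f g`: a single program transforms the list of strings `f i` into `g i`, for every
index `i`, in time polynomial in the size of `f i`. The strings lie on the main stack; the control
stack may hold anything and is left as it was, so that programs can be nested. -/
def Feasible {ι : Type*} (f g : ι → List (List A)) : Prop :=
  ∃ (c : Prog A) (p : Polynomial ℕ), ∀ i D, ∃ t ≤ p.eval (size (f i)),
    Exec c (store (flat (f i)) D []) (store (flat (g i)) D []) t

theorem eval_mono (p : Polynomial ℕ) {m n : ℕ} (h : m ≤ n) : p.eval m ≤ p.eval n := by
  rw [Polynomial.eval_eq_sum_range, Polynomial.eval_eq_sum_range]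
  exact Finset.sum_le_sum fun i _ => Nat.mul_le_mul_left _ (Nat.pow_le_pow_left h i)

/-- As a program adds at most one symbol per unit of time, feasible results have polynomial size. -/
theorem Exec.size_le {c : Prog A} {e e' : List (List A)} {D : List (Option A)} {t : ℕ}
    (h : Exec c (store (flat e) D []) (store (flat e') D []) t) : size e' ≤ size e + t := by
  have := h.total_le
  simp only [Store.total, store_main, store_ctrl, store_aux, length_flat] at this
  simp at this
  omega

namespace Feasible

variable {ι : Type*} {f g : ι → List (List A)} {x y : ι → List A} {r : ι → List (List A)}

theorem refl (f : ι → List (List A)) : Feasible f f :=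
  ⟨.skip, 1, fun _ _ => ⟨1, by simp, Exec.skip _⟩⟩

theorem trans {h : ι → List (List A)} (hfg : Feasible f g) (hgh : Feasible g h) : Feasible f h := by
  obtain ⟨c, p, hc⟩ := hfg
  obtain ⟨d, q, hd⟩ := hgh
  refine ⟨.seq c d, p + q.comp (Polynomial.X + p), fun i D => ?_⟩
  obtain ⟨t, ht, hct⟩ := hc i D
  obtain ⟨u, hu, hdu⟩ := hd i D
  refine ⟨t + u, ?_, hct.seq hdu⟩
  have := hct.size_le
  have := eval_mono q (this.trans (Nat.add_le_add_left ht _))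
  simp only [Polynomial.eval_add, Polynomial.eval_comp, Polynomial.eval_X]
  omega

theorem congr (h : Feasible f g) {g' : ι → List (List A)} (hg : ∀ i, g i = g' i) : Feasible f g' :=
  (funext hg : g = g') ▸ h

/-- A program whose execution time is linear in the size. -/
theorem of_exec (c : Prog A) (k : ℕ)
    (h : ∀ i D, ∃ t ≤ k * (size (f i) + 1),
      Exec c (store (flat (f i)) D []) (store (flat (g i)) D []) t) : Feasible f g :=
  ⟨c, Polynomial.C k * (Polynomial.X + 1), fun i D => by simpa using h i D⟩

theorem nil (h : Feasible f r) : Feasible f (fun i => [] :: r i) :=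
  h.trans (of_exec (.push .main none) 1 fun i _ =>
    ⟨1, by omega, (Exec.push _ _ _).congr (by simp [flat]) rfl⟩)

theorem cons (a : A) (h : Feasible f (fun i => x i :: r i)) :
    Feasible f (fun i => (a :: x i) :: r i) :=
  h.trans (of_exec (.push .main (some a)) 1 fun i _ =>
    ⟨1, by omega, (Exec.push _ _ _).congr (by simp [flat]) rfl⟩)

theorem exec_drop (s : List A) (m c a : List (Option A)) :
    Exec (.loop .main fun _ => .skip) (store (onTop s m) c a) (store m c a) (2 * s.length + 1) := by
  induction s with
  | nil => exact (Exec.loop_done (by simp)).congr (by simp) rfl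
  | cons b s ih =>
    exact (Exec.loop_step (a := b) (by simp) (Exec.skip _)
      (S'' := store m c a) (u := 2 * s.length + 1) (by simpa using ih)).congr rfl (by simp; ring)

theorem drop (h : Feasible f (fun i => x i :: r i)) : Feasible f r :=
  h.trans (of_exec (.loop .main fun _ => .skip) 2 fun i D =>
    ⟨2 * (x i).length + 1, by simp; omega, exec_drop (x i) _ D []⟩)

/-- Transform the strings below the top one. -/
theorem dip {r' : ι → List (List A)} (h : Feasible f (fun i => x i :: r i)) (hr : Feasible r r') :
    Feasible f (fun i => x i :: r' i) := by
  refine h.trans ?_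
  obtain ⟨c, p, hc⟩ := hr
  refine ⟨.seq (.move .main .ctrl) (.seq c (.move .ctrl .main)), 4 * (Polynomial.X + 1) + p,
    fun i D => ?_⟩
  obtain ⟨t, ht, hct⟩ := hc i (onTop (x i).reverse D)
  refine ⟨_, ?_, (exec_move (by simp) (x i) (flat (r i)) _ (isTop_onTop _ _)).seq ((?_ : Exec c _
    (store (flat (r' i)) (onTop (x i).reverse D) []) t).seq
    ((exec_move (by simp) (x i).reverse D _ (isTop_onTop _ _)).congr (by simp [flat]) rfl))⟩
  · have := eval_mono p (show size (r i) ≤ size (x i :: r i) by simp)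
    simp at this ⊢
    omega
  · simpa using hct

/-- Exchange the top two strings: they go to different stacks and return in the other order. -/
theorem swap (h : Feasible f (fun i => x i :: y i :: r i)) :
    Feasible f (fun i => y i :: x i :: r i) := by
  refine h.trans (of_exec (.seq (.move .main .ctrl) (.seq (.move .main .aux)
    (.seq (.move .ctrl .main) (.move .aux .main)))) 8 fun i D => ⟨_, ?_,
      (exec_move (by simp) (x i) (onTop (y i) (flat (r i))) _ (isTop_onTop _ _)).seq
      ((exec_move (by simp) (y i) (flat (r i)) _ ?_).seq
      ((exec_move (by simp) (x i).reverse D _ ?_).seq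
      ((exec_move (by simp) (y i).reverse [] _ ?_).congr ?_ rfl)))⟩)
  · simp; omega
  · simpa using isTop_onTop _ _
  · simpa using isTop_onTop _ _
  · simpa using isTop_onTop _ _
  · simp [flat]

/-- The loop that copies the top string of the control stack to both of the other stacks. -/
theorem exec_dup_loop (s : List A) (m D a : List (Option A)) :
    Exec (.loop .ctrl fun b => .seq (.push .main (some b)) (.push .aux (some b)))
      (store m (onTop s D) a)
      (store (s.reverse.map some ++ m) D (s.reverse.map some ++ a)) (3 * s.length + 1) := by
  induction s generalizing m a with
  | nil => exact (Exec.loop_done (by simp)).congr (by simp) rfl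
  | cons b s ih =>
    refine (Exec.loop_step (a := b) (by simp) (Exec.seq (Exec.push _ _ _) (Exec.push _ _ _))
      (S'' := store ((b :: s).reverse.map some ++ m) D ((b :: s).reverse.map some ++ a))
      (u := 3 * s.length + 1) ?_).congr rfl (by simp; ring)
    simpa using ih (some b :: m) (some b :: a)

/-- Duplicate the top string: it goes to the control stack, from where every letter is pushed
twice. -/
theorem dup (h : Feasible f (fun i => x i :: r i)) : Feasible f (fun i => x i :: x i :: r i) := by
  refine h.trans (of_exec (.seq (.move .main .ctrl) (.seq (.push .main none) (.seq (.push .aux none)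
    (.seq (.loop .ctrl fun b => .seq (.push .main (some b)) (.push .aux (some b)))
    (.seq (.move .aux .ctrl) (.move .ctrl .main)))))) 9 fun i D => ⟨_, ?_,
      (exec_move (by simp) (x i) (flat (r i)) _ (isTop_onTop _ _)).seq ((Exec.push _ _ _).seq
      ((Exec.push _ _ _).seq (Exec.seq
      (S' := store (onTop (x i) (flat (r i))) D (onTop (x i) [])) (t := 3 * (x i).length + 1) ?_
      ((exec_move (by simp) (x i) [] _ (isTop_onTop _ _)).seq
      ((exec_move (by simp) (x i).reverse D _ ?_).congr ?_ rfl)))))⟩)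
  · simp; omega
  · simpa [onTop] using exec_dup_loop (x i).reverse (none :: flat (r i)) D [none]
  · simpa using isTop_onTop _ _
  · simp [flat]

/-- Pop the first letter of the top string, and continue accordingly. -/
theorem uncons [Fintype A] {g : Option A → ι → List (List A)} (h : Feasible f (fun i => x i :: r i))
    (H : ∀ o, Feasible (fun i => (x i).tail :: r i) (g o)) :
    Feasible f (fun i => g (x i).head? i) := by
  classical
  refine h.trans ?_
  choose c p hc using H
  refine ⟨.pop .main fun o => o.elim (.seq (.push .main none) (c none)) fun a => c (some a),
    2 + ∑ o, p o, fun i D => ?_⟩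
  obtain ⟨t, ht, hct⟩ := hc (x i).head? i D
  have h₁ : (p (x i).head?).eval (size ((x i).tail :: r i)) ≤
      (∑ o, p o).eval (size (x i :: r i)) := by
    rw [Polynomial.eval_finsetSum]
    exact (eval_mono _ (by simp)).trans
      (Finset.single_le_sum (f := fun o => (p o).eval (size (x i :: r i)))
        (fun _ _ => Nat.zero_le _) (Finset.mem_univ _))
  rcases hx : x i with _ | ⟨a, s⟩
  · simp only [hx, List.head?_nil, List.tail_nil] at hct ht h₁ ⊢
    refine ⟨1 + t + 1, ?_, Exec.pop ?_⟩
    · simp only [Polynomial.eval_add, Polynomial.eval_ofNat]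
      omega
    · simp only [flat, onTop_nil, store_main, List.head?_cons, Option.join_some, Option.elim_none,
        List.tail_cons, update_store_main]
      exact (Exec.push _ _ _).seq (by simpa [flat] using hct)
  · simp only [hx, List.head?_cons, List.tail_cons] at hct ht h₁ ⊢
    refine ⟨t + 1, ?_, Exec.pop ?_⟩
    · simp only [Polynomial.eval_add, Polynomial.eval_ofNat]
      omega
    · simpa [flat] using hct

/-- Execution of a loop whose body is known, within time `T`, on the states that arise. -/
theorem exec_foldl {σ : Type*} {c : A → Prog A} {step : σ → A → σ} {e : σ → List (List A)}
    (s : List A) (q : σ) (T : ℕ)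
    (h : ∀ s₁ a s₂, s = s₁ ++ a :: s₂ → ∀ D, ∃ t ≤ T,
      Exec (c a) (store (flat (e (s₁.foldl step q))) D [])
        (store (flat (e (step (s₁.foldl step q) a))) D []) t) (D : List (Option A)) :
    ∃ t ≤ s.length * (T + 1) + 1, Exec (.loop .ctrl c) (store (flat (e q)) (onTop s D) [])
      (store (flat (e (s.foldl step q))) D []) t := by
  induction s generalizing q with
  | nil => exact ⟨1, by simp, (Exec.loop_done (by simp)).congr (by simp) rfl⟩
  | cons a s ih =>
    -- During the first round the rest of the string lies on the control stack.
    obtain ⟨t, ht, h₁⟩ := h [] a s rfl (onTop s D)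
    obtain ⟨u, hu, h₂⟩ := ih (step q a) fun s₁ b s₂ hs =>
      h (a :: s₁) b s₂ (by simp [hs])
    refine ⟨_, ?_, Exec.loop_step (a := a) (by simp) (by simpa using h₁) h₂⟩
    simp only [List.length_cons]
    nlinarith

/-- Loop over the letters of the top string. The polynomial `B` bounds the sizes of the intermediate
results, which need not be bounded by the feasibility of a single step. -/
theorem foldl [Fintype A] {σ : Type*} {q : ι → σ} {step : ι → σ → A → σ}
    {e : ι → σ → List (List A)} (h : Feasible f (fun i => x i :: e i (q i)))
    (hstep : ∀ a, Feasible (fun u : ι × σ => e u.1 u.2) (fun u => e u.1 (step u.1 u.2 a)))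
    (B : Polynomial ℕ)
    (hB : ∀ i s, s <+: x i →
      size (e i (s.foldl (step i) (q i))) ≤ B.eval (size (x i :: e i (q i)))) :
    Feasible f (fun i => e i ((x i).foldl (step i) (q i))) := by
  classical
  refine h.trans ?_
  choose c p hc using hstep
  -- Two moves bring the string to the control stack without reversing it.
  refine ⟨.seq (.move .main .aux) (.seq (.move .aux .ctrl) (.loop .ctrl c)),
    4 * (Polynomial.X + 1) + (Polynomial.X * ((∑ a, p a).comp B + 1) + 1), fun i D => ?_⟩
  obtain ⟨t, ht, hct⟩ := exec_foldl (c := c) (e := e i) (step := step i) (x i) (q i)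
    ((∑ a, p a).eval (B.eval (size (x i :: e i (q i)))))
    (fun s₁ a s₂ hs D => by
      obtain ⟨t, ht, hct⟩ := hc a (i, s₁.foldl (step i) (q i)) D
      refine ⟨t, ht.trans ?_, hct⟩
      rw [Polynomial.eval_finsetSum]
      exact (eval_mono _ (hB i s₁ ⟨a :: s₂, hs.symm⟩)).trans
        (Finset.single_le_sum (f := fun a => (p a).eval (B.eval (size (x i :: e i (q i)))))
          (fun _ _ => Nat.zero_le _) (Finset.mem_univ _))) D
  refine ⟨_, ?_, (exec_move (by simp) (x i) (flat (e i (q i))) _ (isTop_onTop _ _)).seq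
    ((exec_move (by simp) (x i).reverse [] _ (by simpa using isTop_onTop _ _)).seq
    (by simpa using hct))⟩
  simp only [Polynomial.eval_add, Polynomial.eval_mul, Polynomial.eval_ofNat, Polynomial.eval_X,
    Polynomial.eval_one, Polynomial.eval_comp, List.length_reverse]
  refine le_trans (Nat.add_le_add_left (Nat.add_le_add_left ht _) _) ?_
  have : (x i).length ≤ size (x i :: e i (q i)) := by simp; omega
  nlinarith [Nat.mul_le_mul_right
    ((∑ a, p a).eval (B.eval (size (x i :: e i (q i)))) + 1) this]

end Feasible

end Feasible

/-! ### From feasible transformations to Turing machines -/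

section Computable

variable {A : Type}

/-- A list of strings as the contents of a stack, without the end marker of the last string. -/
def flatOpen : List (List A) → List (Option A)
  | [] => []
  | [s] => s.map some
  | s :: e => onTop s (flatOpen e)

theorem isTop_flatOpen (s : List A) (e : List (List A)) :
    IsTop (flatOpen (s :: e)) s (flatOpen e) := by
  cases e with
  | nil => exact Or.inr ⟨rfl, rfl⟩
  | cons s' e => exact Or.inl rfl

theorem size_le_length_flatOpen (e : List (List A)) : size e ≤ (flatOpen e).length + 1 := by
  induction e with
  | nil => simp
  | cons s e ih =>
    cases e with
    | nil => simp [flatOpen]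
    | cons s' e => simp only [flatOpen, size_cons, length_onTop] at ih ⊢; omega

/-- Take `n` strings from the main stack and put them back, which closes the last one. -/
def Prog.closeLast : ℕ → Prog A
  | 0 => .skip
  | n + 1 => .seq (.move .main .ctrl) (.seq (closeLast n) (.move .ctrl .main))

theorem exec_closeLast (e : List (List A)) (D : List (Option A)) :
    Exec (.closeLast e.length) (store (flatOpen e) D []) (store (flat e) D []) (4 * size e + 1) := by
  induction e generalizing D with
  | nil => exact Exec.skip _
  | cons s e ih =>
    refine ((exec_move (by simp) s (flatOpen e) _ (isTop_flatOpen s e)).seq (Exec.seq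
      (S' := store (flat e) (onTop s.reverse D) []) (by simpa using ih (onTop s.reverse D))
      ((exec_move (by simp) s.reverse D _ (isTop_onTop _ _)).congr (by simp [flat]) rfl))).congr
      rfl (by simp; ring)

/-- The last statement of the machine: move the answer to the output stack, clear the main stack,
reset the internal state, and halt. -/
def outputStmt (A Λ : Type) : MachineStmt A Λ :=
  .pop (some .main) (fun _ o => o.join) (.push none (fun v => v.isSome)
    (.pop (some .main) (fun _ _ => none) .halt))

/-- The answer is `true` if and only if the string left on the main stack is not empty. The string
must not have more than one letter, as only two symbols are removed. -/
theorem stepAux_outputStmt {Λ : Type} (s : List A) (hs : s.length ≤ 1) (v : Option A) :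
    Turing.TM2.stepAux (outputStmt A Λ) v (Store.lift (store (flat [s]) [] []) []) =
      ⟨none, none, Store.lift (store [] [] []) [!s.isEmpty]⟩ := by
  simp only [outputStmt, Turing.TM2.stepAux, Turing.TM2.Cfg.mk.injEq, true_and]
  funext k
  rcases s with _ | ⟨a, _ | ⟨b, s⟩⟩
  · rcases k with _ | _ | _ | _ <;> rfl
  · rcases k with _ | _ | _ | _ <;> rfl
  · simp at hs

/-- The machine that runs the program `c` after having completed the input. -/
noncomputable def machine [Fintype A] (c : Prog A) : Turing.FinTM2 where
  K := Option Stk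
  k₀ := some .main
  k₁ := none
  Γ := StackAlphabet A
  Λ := c.Label
  main := c.entry
  ΛFin := c.fintypeLabel
  σ := Option A
  initialState := none
  Γk₀Fin := inferInstanceAs (Fintype (Option A))
  m := c.code id (outputStmt A c.Label)

/-- If the list of strings `E a` can feasibly be transformed into the answer, given as a string that
is empty for `false`, then the answer is computable in polynomial time from `E a`, written as one
word with end markers between the strings. -/
theorem Feasible.computableInPolyTime [Fintype A] {α B : Type} {n : ℕ} {E : α → List (List A)}
    (hn : ∀ a, (E a).length = n) (u : Option A ≃ B) {enc : α → List B}
    (henc : ∀ a, enc a = (flatOpen (E a)).map u) {ans : α → Bool} (b : A)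
    (h : Feasible E fun a => [bif ans a then [b] else []]) :
    Nonempty (Turing.TM2ComputableInPolyTime enc Computability.encodeBool ans) := by
  obtain ⟨c, p, hc⟩ := h
  refine ⟨{
    tm := machine (.seq (.closeLast n) c)
    inputAlphabet := u
    outputAlphabet := Equiv.refl Bool
    time := 4 * (Polynomial.X + 1) + 1 + p.comp (Polynomial.X + 1)
    outputsFun := fun a => Classical.choice ?_ }⟩
  obtain ⟨t, ht, hct⟩ := hc a []
  have hex := (hn a ▸ exec_closeLast (E a) []).seq hct
  obtain ⟨v, hv⟩ := hex.code (machine (.seq (.closeLast n) c)).m id (outputStmt A _)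
    (fun _ => rfl) none []
  refine ⟨⟨⟨4 * size (E a) + 1 + t, ?_⟩, ?_⟩⟩
  · refine Eq.trans (congrArg _ (congrArg some ?_)) (hv.trans (congrArg some ?_))
    · have : List.map u.invFun (enc a) = flatOpen (E a) := by
        rw [henc, List.map_map]
        exact (List.map_congr_left fun x _ => u.symm_apply_apply x).trans (List.map_id _)
      simp only [Turing.initList]
      congr 1
      funext k
      rcases k with _ | _ | _ | _
      · rfl
      · exact this
      · rfl
      · rfl
    · rw [stepAux_outputStmt _ (by cases ans a <;> simp)]
      simp only [Turing.haltList]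
      congr 1
      funext k
      rcases k with _ | _ | _ | _
      · cases ans a <;> rfl
      · rfl
      · rfl
      · rfl
  · have h₁ : size (E a) ≤ (enc a).length + 1 := by
      rw [henc, List.length_map]
      exact size_le_length_flatOpen _
    have := eval_mono p h₁
    simp only [Polynomial.eval_add, Polynomial.eval_mul, Polynomial.eval_ofNat, Polynomial.eval_X,
      Polynomial.eval_one, Polynomial.eval_comp]
    omega

end Computable

/-! ### Arithmetic on bit strings -/

/-- The letters other than `Letter.hash`, which serves as the end marker of strings. -/
inductive Sym : Type
  | bit : Bool → Sym
  | var | close | slash | comma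
  | ineg | iand | ior
  | pr
  | cmp : Cmp → Sym
  | neg | delta | odot | oplus | imp
  deriving DecidableEq, Fintype

/-- The bit denoted by a symbol; symbols other than bits count as the bit `0`. -/
def Sym.isOne : Sym → Bool
  | .bit b => b
  | _ => false

/-- The first bit of a string, `0` if there is none. -/
def firstBit : Option Sym → Bool
  | some a => a.isOne
  | none => false

@[simp] theorem firstBit_none : firstBit none = false := rfl
@[simp] theorem firstBit_some (a : Sym) : firstBit (some a) = a.isOne := rfl
@[simp] theorem isOne_bit (b : Bool) : (Sym.bit b).isOne = b := rfl

/-- The number denoted by a string of bits, least significant first. -/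
def num : List Sym → ℕ
  | [] => 0
  | a :: s => a.isOne.toNat + 2 * num s

@[simp] theorem num_nil : num [] = 0 := rfl
@[simp] theorem num_cons (a : Sym) (s : List Sym) : num (a :: s) = a.isOne.toNat + 2 * num s := rfl

theorem num_concat (s : List Sym) (a : Sym) :
    num (s ++ [a]) = num s + 2 ^ s.length * a.isOne.toNat := by
  induction s with
  | nil => simp
  | cons b s ih => simp [ih]; ring

theorem num_bits (n : ℕ) : num (n.bits.map Sym.bit) = n := by
  induction n using Nat.binaryRec' with
  | zero => simp
  | bit b n h ih =>
    rw [Nat.bits_append_bit n b h, List.map_cons, num_cons, ih, Nat.bit_val, isOne_bit]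
    ring

theorem headD_firstBit (y : List Sym) :
    num y = (firstBit y.head?).toNat + 2 * num y.tail := by
  cases y <;> simp

/-- The state of a bitwise operation: the carry, the rest of the second argument, and the bits
produced so far in reverse order. -/
abbrev ZipState : Type := Bool × List Sym × List Sym

/-- One step of a bitwise operation with table `T`, which computes the new carry and the output bit
from the carry and the current bits. -/
def zipStep (T : Bool → Bool → Bool → Bool × Bool) (s : ZipState) (a : Sym) : ZipState :=
  ((T s.1 a.isOne (firstBit s.2.1.head?)).1, s.2.1.tail,
    .bit (T s.1 a.isOne (firstBit s.2.1.head?)).2 :: s.2.2)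

/-- A bitwise operation on two strings, the shorter one being padded with zeros: the final carry and
the output. -/
def zipBits (T : Bool → Bool → Bool → Bool × Bool) (x y : List Sym) : Bool × List Sym :=
  let s := x.foldl (zipStep T) (false, y, [])
  -- What is left of `y` is combined with zeros, by the same table with the arguments exchanged.
  let s' := s.2.1.foldl (zipStep fun c b a => T c a b) (s.1, [], s.2.2)
  (s'.1, s'.2.2.reverse)

theorem foldl_zipStep_tail (T : Bool → Bool → Bool → Bool × Bool) (x : List Sym) (s : ZipState) :
    (x.foldl (zipStep T) s).2.1 = s.2.1.drop x.length := by
  induction x generalizing s with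
  | nil => simp
  | cons a x ih => simp [ih, zipStep]

theorem length_foldl_zipStep (T : Bool → Bool → Bool → Bool × Bool) (x : List Sym) (s : ZipState) :
    (x.foldl (zipStep T) s).2.2.length = s.2.2.length + x.length := by
  induction x generalizing s with
  | nil => simp
  | cons a x ih => simp [ih, zipStep]; omega

theorem length_zipBits (T : Bool → Bool → Bool → Bool × Bool) (x y : List Sym) :
    (zipBits T x y).2.length = max x.length y.length := by
  simp [zipBits, length_foldl_zipStep, foldl_zipStep_tail]
  omega

/-- If every row of the table satisfies `α a + β b + γ c = o + 2 γ c'`, then so does the operation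
as a whole, with numbers for bits. -/
theorem foldl_zipStep_num {T : Bool → Bool → Bool → Bool × Bool} {α β γ : ℤ}
    (hT : ∀ c a b : Bool, α * a.toNat + β * b.toNat + γ * c.toNat =
      (T c a b).2.toNat + 2 * γ * (T c a b).1.toNat) (x : List Sym) (s : ZipState) :
    (num (x.foldl (zipStep T) s).2.2.reverse : ℤ) + 2 ^ (x.foldl (zipStep T) s).2.2.length *
      (β * num (x.foldl (zipStep T) s).2.1 + γ * (x.foldl (zipStep T) s).1.toNat) =
    num s.2.2.reverse + 2 ^ s.2.2.length * (α * num x + β * num s.2.1 + γ * s.1.toNat) := by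
  induction x generalizing s with
  | nil => simp
  | cons a x ih =>
    rw [List.foldl_cons, ih, headD_firstBit s.2.1]
    have := hT s.1 a.isOne (firstBit s.2.1.head?)
    simp only [zipStep, List.reverse_cons, num_concat, List.length_reverse, List.length_cons,
      isOne_bit, num_cons]
    push_cast
    linear_combination -(2 : ℤ) ^ s.2.2.length * this

/-- If every row of the table satisfies `a + γ b + γ c = o + 2 γ c'`, then the operation yields
`x + γ y` up to the final carry. -/
theorem zipBits_num {T : Bool → Bool → Bool → Bool × Bool} {γ : ℤ}
    (hT : ∀ c a b : Bool, (a.toNat : ℤ) + γ * b.toNat + γ * c.toNat =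
      (T c a b).2.toNat + 2 * γ * (T c a b).1.toNat) (x y : List Sym) :
    (num (zipBits T x y).2 : ℤ) + 2 ^ (zipBits T x y).2.length * (γ * (zipBits T x y).1.toNat) =
      num x + γ * num y := by
  have h₁ := foldl_zipStep_num (α := 1) (β := γ) (γ := γ) (T := T) (by simpa using hT) x
    (false, y, [])
  have h₂ := foldl_zipStep_num (α := γ) (β := 1) (γ := γ) (T := fun c b a => T c a b)
    (fun c b a => by rw [← hT c a b]; ring) (x.foldl (zipStep T) (false, y, [])).2.1
    ((x.foldl (zipStep T) (false, y, [])).1, [], (x.foldl (zipStep T) (false, y, [])).2.2)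
  rw [foldl_zipStep_tail _ _ (_, ([] : List Sym), _)] at h₂
  simp only [List.drop_nil, num_nil, Nat.cast_zero, mul_zero, zero_add, add_zero] at h₂
  simp only [zipBits, List.length_reverse]
  rw [h₂, h₁]
  simp

/-- The full adder. -/
def adder (c a b : Bool) : Bool × Bool := ((a && b) || (a && c) || (b && c), (a ^^ b) ^^ c)

/-- The full subtractor. -/
def subtractor (c a b : Bool) : Bool × Bool := ((!a && b) || (!a && c) || (b && c), (a ^^ b) ^^ c)

/-- Addition. -/
def addStr (x y : List Sym) : List Sym := (zipBits adder x y).2 ++ [.bit (zipBits adder x y).1]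

/-- Truncated subtraction: a final borrow means that the result is negative. -/
def subStr (x y : List Sym) : List Sym :=
  bif (zipBits subtractor x y).1 then [] else (zipBits subtractor x y).2

/-- Multiplication, by Horner's scheme. -/
def mulStr (x y : List Sym) : List Sym :=
  x.foldr (fun a z => bif a.isOne then addStr y (.bit false :: z) else .bit false :: z) []

/-- Test for zero. -/
def isZeroStr (x : List Sym) : Bool := x.foldl (fun z a => z && !a.isOne) true

@[simp] theorem num_addStr (x y : List Sym) : num (addStr x y) = num x + num y := by
  have := zipBits_num (T := adder) (γ := 1) (by decide) x y
  rw [addStr, num_concat]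
  simp only [isOne_bit]
  zify
  linarith

theorem length_addStr (x y : List Sym) :
    (addStr x y).length = max x.length y.length + 1 := by
  simp [addStr, length_zipBits]

theorem num_lt_two_pow (x : List Sym) : num x < 2 ^ x.length := by
  induction x with
  | nil => simp
  | cons a x ih =>
    have : a.isOne.toNat ≤ 1 := Bool.toNat_le _
    simp only [num_cons, List.length_cons, pow_succ]
    omega

@[simp] theorem num_subStr (x y : List Sym) : num (subStr x y) = num x - num y := by
  have h := zipBits_num (T := subtractor) (γ := -1) (by decide) x y
  have h' := num_lt_two_pow (zipBits subtractor x y).2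
  rw [subStr]
  cases hc : (zipBits subtractor x y).1
  · simp only [hc, Bool.toNat_false, cond_false] at h ⊢
    omega
  · simp only [hc, Bool.toNat_true, cond_true, num_nil] at h ⊢
    zify at h'
    have : (num x : ℤ) < num y := by push_cast at h; linarith
    omega

theorem length_subStr (x y : List Sym) : (subStr x y).length ≤ max x.length y.length := by
  rw [subStr]
  cases (zipBits subtractor x y).1 <;> simp [length_zipBits]

@[simp] theorem num_mulStr (x y : List Sym) : num (mulStr x y) = num x * num y := by
  induction x with
  | nil => simp [mulStr]
  | cons a x ih =>
    have : mulStr (a :: x) y = bif a.isOne then addStr y (.bit false :: mulStr x y)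
      else .bit false :: mulStr x y := rfl
    rw [this]
    cases h : a.isOne <;> simp [ih, h] <;> ring

theorem length_mulStr (x y : List Sym) : (mulStr x y).length ≤ y.length + 2 * x.length := by
  induction x with
  | nil => simp [mulStr]
  | cons a x ih =>
    have : mulStr (a :: x) y = bif a.isOne then addStr y (.bit false :: mulStr x y)
      else .bit false :: mulStr x y := rfl
    rw [this]
    cases h : a.isOne <;> simp [length_addStr] <;> omega

theorem isZeroStr_eq (x : List Sym) : isZeroStr x = decide (num x = 0) := by
  have : ∀ z, x.foldl (fun z a => z && !a.isOne) z = (z && decide (num x = 0)) := by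
    induction x with
    | nil => simp
    | cons a x ih =>
      intro z
      rw [List.foldl_cons, ih]
      cases h : a.isOne <;> simp [h]
  rw [isZeroStr, this, Bool.true_and]

/-- Test for the equality of two numbers. -/
def eqStr (x y : List Sym) : Bool := isZeroStr (addStr (subStr x y) (subStr y x))

theorem eqStr_eq (x y : List Sym) : eqStr x y = decide (num x = num y) := by
  rw [eqStr, isZeroStr_eq, num_addStr, num_subStr, num_subStr, decide_eq_decide]
  omega

namespace Feasible

section Rules

variable {ι : Type*} {f r : ι → List (List Sym)} {x y z w v : ι → List Sym}

theorem pick1 (h : Feasible f (fun i => x i :: y i :: r i)) :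
    Feasible f (fun i => y i :: x i :: y i :: r i) := (h.dip (refl _).dup).swap

theorem pick2 (h : Feasible f (fun i => x i :: y i :: z i :: r i)) :
    Feasible f (fun i => z i :: x i :: y i :: z i :: r i) := (h.dip (refl _).pick1).swap

theorem pick3 (h : Feasible f (fun i => x i :: y i :: z i :: w i :: r i)) :
    Feasible f (fun i => w i :: x i :: y i :: z i :: w i :: r i) := (h.dip (refl _).pick2).swap

theorem pick4 (h : Feasible f (fun i => x i :: y i :: z i :: w i :: v i :: r i)) :
    Feasible f (fun i => v i :: x i :: y i :: z i :: w i :: v i :: r i) :=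
  (h.dip (refl _).pick3).swap

/-- Remove the string below the top one. -/
theorem nip (h : Feasible f (fun i => x i :: y i :: r i)) : Feasible f (fun i => x i :: r i) :=
  h.dip (refl _).drop

theorem reverse (h : Feasible f (fun i => x i :: r i)) :
    Feasible f (fun i => (x i).reverse :: r i) := by
  refine Feasible.congr (Feasible.foldl (q := fun _ => []) (step := fun _ s a => a :: s)
    (e := fun i s => s :: r i) h.nil.swap (fun a => (refl _).cons a) Polynomial.X ?_) ?_
  · intro i s hs
    have := hs.length_le
    simp
    omega
  · simp

/-- Append a letter to the top string. -/
theorem concat (a : Sym) (h : Feasible f (fun i => x i :: r i)) :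
    Feasible f (fun i => (x i ++ [a]) :: r i) :=
  (h.reverse.cons a).reverse.congr (by simp)

theorem append (h : Feasible f (fun i => x i :: y i :: r i)) :
    Feasible f (fun i => (x i ++ y i) :: r i) := by
  refine Feasible.congr (Feasible.foldl (q := y) (step := fun _ s a => a :: s)
    (e := fun i s => s :: r i) h.reverse (fun a => (refl _).cons a) Polynomial.X ?_) ?_
  · intro i s hs
    have := hs.length_le
    simp at this ⊢
    omega
  · simp

/-- A bit string of length one on top. -/
theorem pushBit (b : Bool) (h : Feasible f r) : Feasible f (fun i => [.bit b] :: r i) :=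
  h.nil.cons (.bit b)

/-- Pop a bit and continue accordingly. -/
theorem popBit {b : ι → Bool} {g : Bool → ι → List (List Sym)}
    (h : Feasible f (fun i => [.bit (b i)] :: r i)) (H : ∀ b, Feasible r (g b)) :
    Feasible f (fun i => g (b i) i) :=
  Feasible.congr (h.uncons (g := fun o => g (firstBit o)) fun _ => (refl _).drop.trans (H _))
    fun _ => rfl

/-- Conditional. -/
theorem ite {b : ι → Bool} {g₁ g₀ : ι → List (List Sym)}
    (h : Feasible f (fun i => [.bit (b i)] :: r i)) (h₁ : Feasible r g₁) (h₀ : Feasible r g₀) :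
    Feasible f (fun i => bif b i then g₁ i else g₀ i) :=
  h.popBit (g := fun b i => bif b then g₁ i else g₀ i) fun b => by cases b <;> assumption

theorem zipStep (T : Bool → Bool → Bool → Bool × Bool) (a : Sym) {s : ι → ZipState}
    (h : Feasible f (fun i => [.bit (s i).1] :: (s i).2.1 :: (s i).2.2 :: r i)) :
    Feasible f (fun i => [.bit (zipStep T (s i) a).1] :: (zipStep T (s i) a).2.1 ::
      (zipStep T (s i) a).2.2 :: r i) :=
  h.popBit (g := fun c i => [.bit (FPAbduction.zipStep T (c, (s i).2) a).1] ::
      (FPAbduction.zipStep T (c, (s i).2) a).2.1 ::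
      (FPAbduction.zipStep T (c, (s i).2) a).2.2 :: r i) fun c =>
    (refl _).uncons (g := fun o i => [.bit (T c a.isOne (firstBit o)).1] :: (s i).2.1.tail ::
      (.bit (T c a.isOne (firstBit o)).2 :: (s i).2.2) :: r i) fun o =>
    ((refl _).swap.cons (.bit (T c a.isOne (firstBit o)).2)).swap.pushBit
      (T c a.isOne (firstBit o)).1

theorem foldl_zipStep (T : Bool → Bool → Bool → Bool × Bool) {s : ι → ZipState}
    (h : Feasible f (fun i => x i :: [.bit (s i).1] :: (s i).2.1 :: (s i).2.2 :: r i)) :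
    Feasible f (fun i => [.bit ((x i).foldl (FPAbduction.zipStep T) (s i)).1] ::
      ((x i).foldl (FPAbduction.zipStep T) (s i)).2.1 ::
      ((x i).foldl (FPAbduction.zipStep T) (s i)).2.2 :: r i) := by
  refine Feasible.foldl (q := s) (step := fun _ => FPAbduction.zipStep T)
    (e := fun i s => [.bit s.1] :: s.2.1 :: s.2.2 :: r i) h (fun a => zipStep T a (refl _))
    Polynomial.X ?_
  intro i s hs
  have := hs.length_le
  simp [length_foldl_zipStep, foldl_zipStep_tail]
  omega

theorem zipBits (T : Bool → Bool → Bool → Bool × Bool)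
    (h : Feasible f (fun i => x i :: y i :: r i)) :
    Feasible f (fun i => [.bit (zipBits T (x i) (y i)).1] :: (zipBits T (x i) (y i)).2 :: r i) := by
  have h₁ := foldl_zipStep T (s := fun i => (false, y i, []))
    ((h.dip ((refl _).dip (refl _).nil)).dip ((refl _).pushBit false))
  have h₂ := foldl_zipStep (fun c b a => T c a b)
    (s := fun i => (((x i).foldl (FPAbduction.zipStep T) (false, y i, [])).1, [],
      ((x i).foldl (FPAbduction.zipStep T) (false, y i, [])).2.2))
    ((h₁.dip ((refl _).dip (refl _).nil)).swap)
  exact h₂.dip (refl _).drop.reverse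

theorem addStr (h : Feasible f (fun i => x i :: y i :: r i)) :
    Feasible f (fun i => addStr (x i) (y i) :: r i) :=
  (h.zipBits adder).popBit (g := fun b i =>
    ((FPAbduction.zipBits adder (x i) (y i)).2 ++ [.bit b]) :: r i) fun b => (refl _).concat (.bit b)

theorem subStr (h : Feasible f (fun i => x i :: y i :: r i)) :
    Feasible f (fun i => subStr (x i) (y i) :: r i) :=
  ((h.zipBits subtractor).ite (refl _).drop.nil (refl _)).congr fun i => by
    rw [FPAbduction.subStr]; cases (FPAbduction.zipBits subtractor (x i) (y i)).1 <;> rfl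

theorem mulStr (h : Feasible f (fun i => x i :: y i :: r i)) :
    Feasible f (fun i => mulStr (x i) (y i) :: r i) := by
  refine (Feasible.congr (Feasible.foldl (q := fun _ => [])
    (step := fun i z a => bif a.isOne then FPAbduction.addStr (y i) (Sym.bit false :: z)
      else Sym.bit false :: z)
    (e := fun i z => z :: y i :: r i) (h.reverse.dip (refl _).nil) (fun a => ?_)
    (3 * Polynomial.X) ?_) (g' := fun i => FPAbduction.mulStr (x i) (y i) :: y i :: r i) ?_).nip
  · cases h : a.isOne
    · exact (refl _).cons (Sym.bit false)
    · exact ((refl _).cons (Sym.bit false)).pick1.addStr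
  · intro i s hs
    have := hs.length_le
    have h₁ := length_mulStr s.reverse (y i)
    rw [FPAbduction.mulStr, List.foldr_reverse] at h₁
    simp at this h₁ ⊢
    omega
  · intro i
    rw [List.foldl_reverse]
    rfl

theorem isZeroStr (h : Feasible f (fun i => x i :: r i)) :
    Feasible f (fun i => [.bit (isZeroStr (x i))] :: r i) := by
  refine Feasible.foldl (q := fun _ => true) (step := fun _ z a => z && !a.isOne)
    (e := fun i z => [.bit z] :: r i) (h.dip ((refl _).pushBit true)) (fun a => ?_)
    Polynomial.X ?_
  · cases h : a.isOne
    · exact (refl _).congr (by simp)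
    · exact ((refl _).drop.pushBit false).congr (by simp)
  · intro i s _
    simp

theorem eqStr (h : Feasible f (fun i => x i :: y i :: r i)) :
    Feasible f (fun i => [.bit (eqStr (x i) (y i))] :: r i) :=
  ((h.pick1.pick1.subStr).dip (refl _).swap.subStr).addStr.isZeroStr

theorem and {b c : ι → Bool} (h : Feasible f (fun i => [.bit (b i)] :: [.bit (c i)] :: r i)) :
    Feasible f (fun i => [.bit (b i && c i)] :: r i) :=
  h.popBit (g := fun b i => [.bit (b && c i)] :: r i) fun b =>
    (refl _).popBit (g := fun c i => [.bit (b && c)] :: r i) fun c => (refl _).pushBit (b && c)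

theorem or {b c : ι → Bool} (h : Feasible f (fun i => [.bit (b i)] :: [.bit (c i)] :: r i)) :
    Feasible f (fun i => [.bit (b i || c i)] :: r i) :=
  h.popBit (g := fun b i => [.bit (b || c i)] :: r i) fun b =>
    (refl _).popBit (g := fun c i => [.bit (b || c)] :: r i) fun c => (refl _).pushBit (b || c)

theorem not {b : ι → Bool} (h : Feasible f (fun i => [.bit (b i)] :: r i)) :
    Feasible f (fun i => [.bit !(b i)] :: r i) :=
  h.popBit (g := fun b i => [.bit !b] :: r i) fun b => (refl _).pushBit !b

end Rules

end Feasible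

/-! ### Evaluation of inner formulas -/

/-- The state when a term is searched for a variable: the index being read, whether the literal read
last is about the variable, and whether the variable is true so far. -/
structure Lookup : Type where
  cur : List Sym
  hit : Bool
  val : Bool

/-- One step of the search for the variable with index `key`. -/
def lookupStep (key : List Sym) (s : Lookup) : Sym → Lookup
  | .var => { s with cur := [] }
  | .bit b => { s with cur := s.cur ++ [.bit b] }
  | .close => { s with hit := eqStr s.cur key, val := s.val || eqStr s.cur key }
  | .ineg => { s with val := s.val && !s.hit }
  | _ => s

/-- The truth value of the variable with index `key` according to the term `τ`. -/
def lookup (key τ : List Sym) : Bool := (τ.foldl (lookupStep key) ⟨[], false, false⟩).val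

theorem length_foldl_lookupStep (key τ : List Sym) (s : Lookup) :
    (τ.foldl (lookupStep key) s).cur.length ≤ s.cur.length + τ.length := by
  induction τ generalizing s with
  | nil => simp
  | cons a τ ih =>
    have h : (lookupStep key s a).cur.length ≤ s.cur.length + 1 := by cases a <;> simp [lookupStep]
    have := ih (lookupStep key s a)
    simp only [List.foldl_cons, List.length_cons]
    omega

/-- The state when an inner formula is evaluated: the variable index being read, and a stack of
truth values. -/
structure Eval : Type where
  cur : List Sym
  vals : List Sym

/-- One step of the evaluation of an inner formula under the assignment given by the term `τ`. -/
def evalStep (τ : List Sym) (s : Eval) : Sym → Eval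
  | .var => { s with cur := [] }
  | .bit b => { s with cur := s.cur ++ [.bit b] }
  | .close => { s with vals := .bit (lookup s.cur τ) :: s.vals }
  | .ineg => { s with vals := .bit (!firstBit s.vals.head?) :: s.vals.tail }
  | .iand => ⟨s.cur, .bit (firstBit s.vals.head? && firstBit s.vals.tail.head?) :: s.vals.tail.tail⟩
  | .ior => ⟨s.cur, .bit (firstBit s.vals.head? || firstBit s.vals.tail.head?) :: s.vals.tail.tail⟩
  | _ => s

/-- The truth value of the inner formula `φ` under the assignment given by the term `τ`. -/
def evalInner (τ φ : List Sym) : Bool :=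
  firstBit (φ.foldl (evalStep τ) ⟨[], []⟩).vals.head?

theorem length_foldl_evalStep (τ φ : List Sym) (s : Eval) :
    (φ.foldl (evalStep τ) s).cur.length + (φ.foldl (evalStep τ) s).vals.length ≤
      s.cur.length + s.vals.length + φ.length := by
  induction φ generalizing s with
  | nil => simp
  | cons a φ ih =>
    have h : (evalStep τ s a).cur.length + (evalStep τ s a).vals.length ≤
        s.cur.length + s.vals.length + 1 := by
      cases a <;> simp [evalStep] <;> omega
    have := ih (evalStep τ s a)
    simp only [List.foldl_cons, List.length_cons]
    omega

namespace Feasible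

section Rules

variable {ι : Type*} {f r r' : ι → List (List Sym)} {x y z w v a b c : ι → List Sym}

/-- If a string can be brought to the top, then it can also be brought past a further string. -/
theorem lift (h : Feasible f (fun i => x i :: r i)) (H : Feasible r (fun i => y i :: r' i)) :
    Feasible f (fun i => y i :: x i :: r' i) := (h.dip H).swap

/-- Use the top string below the next one. -/
theorem sink (h : Feasible f (fun i => x i :: y i :: r i))
    (H : Feasible (fun i => x i :: r i) r') : Feasible f (fun i => y i :: r' i) := h.swap.dip H

theorem pick5 (h : Feasible f (fun i => x i :: y i :: z i :: w i :: v i :: a i :: r i)) :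
    Feasible f (fun i => a i :: x i :: y i :: z i :: w i :: v i :: a i :: r i) :=
  h.lift (refl _).pick4

theorem pick6 (h : Feasible f (fun i => x i :: y i :: z i :: w i :: v i :: a i :: b i :: r i)) :
    Feasible f (fun i => b i :: x i :: y i :: z i :: w i :: v i :: a i :: b i :: r i) :=
  h.lift (refl _).pick5

theorem pick7 (h : Feasible f
      (fun i => x i :: y i :: z i :: w i :: v i :: a i :: b i :: c i :: r i)) :
    Feasible f (fun i => c i :: x i :: y i :: z i :: w i :: v i :: a i :: b i :: c i :: r i) :=
  h.lift (refl _).pick6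

/-- Insert the top string below the next four. -/
theorem bury4 (h : Feasible f (fun i => x i :: y i :: z i :: w i :: v i :: r i)) :
    Feasible f (fun i => y i :: z i :: w i :: v i :: x i :: r i) :=
  h.sink ((refl _).sink ((refl _).sink (refl _).swap))

/-- Insert the top string below the next seven. -/
theorem bury7 (h : Feasible f
      (fun i => x i :: y i :: z i :: w i :: v i :: a i :: b i :: c i :: r i)) :
    Feasible f (fun i => y i :: z i :: w i :: v i :: a i :: b i :: c i :: x i :: r i) :=
  h.sink ((refl _).sink ((refl _).sink (refl _).bury4))

/-- Transform the strings below the top four. -/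
theorem dip4 (h : Feasible f (fun i => x i :: y i :: z i :: w i :: r i)) (H : Feasible r r') :
    Feasible f (fun i => x i :: y i :: z i :: w i :: r' i) :=
  h.dip ((refl _).dip ((refl _).dip ((refl _).dip H)))

/-- Transform the strings below the top seven. -/
theorem dip7 (h : Feasible f (fun i => x i :: y i :: z i :: w i :: v i :: a i :: b i :: r i))
    (H : Feasible r r') :
    Feasible f (fun i => x i :: y i :: z i :: w i :: v i :: a i :: b i :: r' i) :=
  h.dip4 ((refl _).dip ((refl _).dip ((refl _).dip H)))

theorem lookupStep (a : Sym) {key : ι → List Sym} {s : ι → Lookup} (h : Feasible f (fun i =>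
      [Sym.bit (s i).hit] :: [Sym.bit (s i).val] :: (s i).cur :: key i :: r i)) :
    Feasible f (fun i => [Sym.bit (lookupStep (key i) (s i) a).hit] ::
      [Sym.bit (lookupStep (key i) (s i) a).val] :: (lookupStep (key i) (s i) a).cur ::
      key i :: r i) := by
  cases a
  case var => exact h.dip ((refl _).dip (refl _).drop.nil)
  case bit b => exact h.dip ((refl _).dip ((refl _).concat (Sym.bit b)))
  case close => exact (h.drop.dip (refl _).pick1.pick1.eqStr).pick1.dip (refl _).or
  case ineg => exact h.dup.dip (refl _).not.swap.and
  all_goals exact h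

theorem lookup {key τ : ι → List Sym} (h : Feasible f (fun i => key i :: τ i :: r i)) :
    Feasible f (fun i => [Sym.bit (lookup (key i) (τ i))] :: r i) := by
  refine (Feasible.foldl (q := fun _ => ⟨[], false, false⟩)
    (step := fun i => FPAbduction.lookupStep (key i))
    (e := fun i s => [Sym.bit s.hit] :: [Sym.bit s.val] :: s.cur :: key i :: r i)
    (h.swap.dip (((refl _).nil.pushBit false).pushBit false))
    (fun a => lookupStep a (refl _)) Polynomial.X ?_).drop.nip.nip
  intro i s hs
  have := hs.length_le
  have := length_foldl_lookupStep (key i) s ⟨[], false, false⟩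
  simp at this ⊢
  omega

theorem evalStep (a : Sym) {τ : ι → List Sym} {s : ι → Eval} (h : Feasible f (fun i =>
      (s i).cur :: (s i).vals :: τ i :: r i)) :
    Feasible f (fun i => (evalStep (τ i) (s i) a).cur :: (evalStep (τ i) (s i) a).vals ::
      τ i :: r i) := by
  cases a
  case var => exact h.drop.nil
  case bit b => exact h.concat (Sym.bit b)
  case close =>
    exact h.pick2.pick1.lookup.popBit (g := fun b i => (s i).cur :: (Sym.bit b :: (s i).vals) ::
      τ i :: r i) fun b => (refl _).dip ((refl _).cons (Sym.bit b))
  case ineg =>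
    exact h.dip ((refl _).uncons (g := fun o i => (Sym.bit (!firstBit o) :: (s i).vals.tail) ::
      τ i :: r i) fun o => (refl _).cons (Sym.bit (!firstBit o)))
  case iand =>
    exact h.dip ((refl _).uncons (g := fun o i =>
      (Sym.bit (firstBit o && firstBit (s i).vals.tail.head?) :: (s i).vals.tail.tail) ::
      τ i :: r i) fun o => (refl _).uncons (g := fun o' i =>
      (Sym.bit (firstBit o && firstBit o') :: (s i).vals.tail.tail) :: τ i :: r i) fun o' =>
      (refl _).cons (Sym.bit (firstBit o && firstBit o')))
  case ior =>
    exact h.dip ((refl _).uncons (g := fun o i =>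
      (Sym.bit (firstBit o || firstBit (s i).vals.tail.head?) :: (s i).vals.tail.tail) ::
      τ i :: r i) fun o => (refl _).uncons (g := fun o' i =>
      (Sym.bit (firstBit o || firstBit o') :: (s i).vals.tail.tail) :: τ i :: r i) fun o' =>
      (refl _).cons (Sym.bit (firstBit o || firstBit o')))
  all_goals exact h

theorem evalInner {τ φ : ι → List Sym} (h : Feasible f (fun i => φ i :: τ i :: r i)) :
    Feasible f (fun i => [Sym.bit (evalInner (τ i) (φ i))] :: r i) := by
  refine ((Feasible.foldl (q := fun _ => ⟨[], []⟩)
    (step := fun i => FPAbduction.evalStep (τ i))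
    (e := fun i s => s.cur :: s.vals :: τ i :: r i) (h.dip (refl _).nil.nil)
    (fun a => evalStep a (refl _)) Polynomial.X ?_).drop.nip).uncons
    (g := fun o i => [Sym.bit (firstBit o)] :: r i) fun o => (refl _).drop.pushBit (firstBit o)
  intro i s hs
  have := hs.length_le
  have := length_foldl_evalStep (τ i) s ⟨[], []⟩
  simp at this ⊢
  omega

/-- Put the first string on top, an empty string if there is none. -/
theorem ensure {g : ι → List (List Sym)} (h : Feasible f g) :
    Feasible f (fun i => (g i).headD [] :: (g i).tail) := by
  refine h.trans (of_exec (.seq (.move .main .ctrl) (.move .ctrl .main)) 4 fun i D => ⟨_, ?_,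
    (exec_move (by simp) ((g i).headD []) (flat (g i).tail) _ ?_).seq
    ((exec_move (by simp) ((g i).headD []).reverse D _ ?_).congr ?_ rfl)⟩)
  · cases g i <;> simp; omega
  · cases g i
    · exact Or.inr ⟨rfl, rfl⟩
    · exact Or.inl rfl
  · simpa using isTop_onTop _ _
  · simp [flat]

end Rules

end Feasible

/-! ### Scanning outer formulas -/

/-- The state of the scanner of outer formulas: the inner formula read last, the comparison symbol
if a comparison is being read, and the denominator and the numerator read so far. Digits are gathered
in `den`, from where `slash` moves them to `numer`. -/
structure Scan : Type where
  text : List Sym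
  mode : Option Cmp
  den : List Sym
  numer : List Sym

/-- The initial state of the scanner. -/
def Scan.start : Scan := ⟨[], none, [], []⟩

/-- The symbols in inner formulas. -/
def Sym.isInner : Sym → Bool
  | .var | .bit _ | .close | .ineg | .iand | .ior => true
  | _ => false

/-- One step of the scanner. -/
def Scan.next (p : Scan) (a : Sym) : Scan :=
  match p.mode with
  | none =>
    match a with
    | .cmp d => { p with mode := some d }
    | .pr => { p with text := [] }
    | a => bif a.isInner then { p with text := p.text ++ [a] } else p
  | some _ =>
    match a with
    | .bit b => { p with den := p.den ++ [Sym.bit b] }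
    | .slash => { p with den := [], numer := p.den }
    | .close => .start
    | _ => p

/-- A comparison mode as a string. -/
def modeStr : Option Cmp → List Sym
  | none => []
  | some d => [.cmp d]

/-- The state of the scanner, as strings on top of others. -/
def Scan.strings (p : Scan) (r : List (List Sym)) : List (List Sym) :=
  p.text :: modeStr p.mode :: p.den :: p.numer :: r

/-- The number of symbols stored by the scanner. -/
def Scan.length (p : Scan) : ℕ := p.text.length + p.den.length + p.numer.length

theorem Scan.length_next (p : Scan) (a : Sym) : (p.next a).length ≤ p.length + 1 := by
  obtain ⟨t, m, d, n⟩ := p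
  cases m <;> cases a <;> simp [Scan.next, Scan.length, Sym.isInner, Scan.start] <;> omega

theorem Scan.size_strings (p : Scan) (r : List (List Sym)) :
    size (p.strings r) ≤ p.length + 5 + size r := by
  obtain ⟨t, m, d, n⟩ := p
  cases m <;> simp [Scan.strings, Scan.length, modeStr] <;> omega

/-- One step of a scan that performs an action, depending on the scanner. -/
def scanStep {σ : Type*} (act : Scan → σ → Sym → σ) (u : Scan × σ) (a : Sym) : Scan × σ :=
  (u.1.next a, act u.1 u.2 a)

theorem length_foldl_scanStep {σ : Type*} (act : Scan → σ → Sym → σ) (x : List Sym)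
    (u : Scan × σ) : (x.foldl (scanStep act) u).1.length ≤ u.1.length + x.length := by
  induction x generalizing u with
  | nil => simp
  | cons a x ih =>
    have := ih (scanStep act u a)
    have := u.1.length_next a
    simp only [List.foldl_cons, List.length_cons, scanStep] at *
    omega

namespace Feasible

section Rules

variable {ι : Type*} {f r : ι → List (List Sym)}

/-- Pop a comparison mode and continue accordingly. -/
theorem popMode {m : ι → Option Cmp} {g : Option Cmp → ι → List (List Sym)}
    (h : Feasible f (fun i => modeStr (m i) :: r i)) (H : ∀ m, Feasible r (g m)) :
    Feasible f (fun i => g (m i) i) := by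
  let dec : Option Sym → Option Cmp := fun o => match o with
    | some (.cmp d) => some d
    | _ => none
  refine Feasible.congr (h.uncons (g := fun o => g (dec o)) fun _ => (refl _).drop.trans (H _))
    fun i => ?_
  cases m i <;> rfl

theorem scanNext (a : Sym) {p : ι → Scan} (h : Feasible f (fun i => (p i).strings (r i))) :
    Feasible f (fun i => ((p i).next a).strings (r i)) := by
  refine (Feasible.popMode (r := fun i => (p i).text :: (p i).den :: (p i).numer :: r i)
    (m := fun i => (p i).mode) (g := fun m i => (Scan.next ⟨(p i).text, m, (p i).den,
      (p i).numer⟩ a).strings (r i)) h.swap ?_)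
  intro m
  cases m with
  | none =>
    cases a
    case cmp d => exact ((refl _).nil.cons (Sym.cmp d)).swap
    case pr => exact (refl _).drop.nil.nil.swap
    case bit b => exact ((refl _).concat (Sym.bit b)).nil.swap
    case var => exact ((refl _).concat Sym.var).nil.swap
    case close => exact ((refl _).concat Sym.close).nil.swap
    case ineg => exact ((refl _).concat Sym.ineg).nil.swap
    case iand => exact ((refl _).concat Sym.iand).nil.swap
    case ior => exact ((refl _).concat Sym.ior).nil.swap
    all_goals exact (refl _).nil.swap
  | some d =>
    have h₀ := ((refl fun i => (p i).text :: (p i).den :: (p i).numer :: r i).nil.cons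
      (Sym.cmp d)).swap
    cases a
    case bit b => exact h₀.dip ((refl _).dip ((refl _).concat (Sym.bit b)))
    case slash => exact h₀.dip ((refl _).dip (refl _).nip.nil)
    case close => exact h₀.drop.drop.drop.drop.nil.nil.nil.nil
    all_goals exact h₀

/-- Scanning a string is feasible if each action is, and if the results remain small. -/
theorem scan {σ : Type*} {x : ι → List Sym} {q : ι → σ} {act : ι → Scan → σ → Sym → σ}
    {e : ι → σ → List (List Sym)} (h : Feasible f (fun i => x i :: e i (q i)))
    (hact : ∀ a, Feasible (fun u : ι × Scan × σ => u.2.1.strings (e u.1 u.2.2))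
      (fun u => u.2.1.strings (e u.1 (act u.1 u.2.1 u.2.2 a))))
    (B : Polynomial ℕ)
    (hB : ∀ i s, s <+: x i → size (e i (s.foldl (scanStep (act i)) (.start, q i)).2) ≤
      B.eval (size (x i :: e i (q i)))) :
    Feasible f (fun i => e i ((x i).foldl (scanStep (act i)) (.start, q i)).2) := by
  refine (Feasible.foldl (q := fun i => (Scan.start, q i)) (step := fun i => scanStep (act i))
    (e := fun i u => u.1.strings (e i u.2)) (h.dip (refl _).nil.nil.nil.nil)
    (fun a => scanNext a (hact a)) (Polynomial.X + 5 + B) ?_).drop.drop.drop.drop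
  intro i s hs
  have h₁ := (Scan.size_strings (s.foldl (scanStep (act i)) (.start, q i)).1
    (e i (s.foldl (scanStep (act i)) (.start, q i)).2))
  have h₂ := length_foldl_scanStep (act i) s (.start, q i)
  have h₃ : size (x i :: e i (q i)) ≤ size (x i :: Scan.start.strings (e i (q i))) := by
    simp [Scan.strings]; omega
  have h₄ := (hB i s hs).trans (eval_mono B h₃)
  have h₅ := hs.length_le
  have h₆ : Scan.start.length = 0 := rfl
  simp only [Polynomial.eval_add, Polynomial.eval_X, Polynomial.eval_ofNat]
  simp only [size_cons] at h₃ h₄ ⊢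
  simp only [h₆] at h₂
  omega

end Rules

end Feasible

/-! ### Probabilities and values of outer formulas as fractions over a common denominator -/

/-- A fraction: numerator and denominator as bit strings. -/
structure Frac : Type where
  total : List Sym
  denom : List Sym

/-- The action when a candidate is scanned in order to find the probability of `φ`. After a conjunct
`Pr(τ) ≤ p / q`, the fraction is extended to the denominator multiplied by `q`, and `p / q` is added
if `τ` entails `φ`. -/
def massStep (φ : List Sym) (p : Scan) (s : Frac) (a : Sym) : Frac :=
  match p.mode, a with
  | some .le, .close =>
    ⟨addStr (mulStr p.den s.total)
      (mulStr (bif evalInner p.text φ then p.numer else []) s.denom), mulStr p.den s.denom⟩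
  | _, _ => s

/-- The probability of `φ` in the model described by the candidate `θ`. -/
def mass (θ φ : List Sym) : Frac :=
  (θ.foldl (scanStep (massStep φ)) (.start, ⟨[], [.bit true]⟩)).2

theorem massStep_of_ne {a : Sym} (h : a ≠ .close) (φ : List Sym) (p : Scan) (s : Frac) :
    massStep φ p s a = s := by
  unfold massStep
  split
  · exact absurd rfl h
  · rfl

/-- At each step, the lengths grow by at most twice the number of digits read, plus one. -/
theorem length_foldl_massStep (φ x : List Sym) :
    (x.foldl (scanStep (massStep φ)) (.start, ⟨[], [.bit true]⟩)).2.total.length ≤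
      1 + x.length * (2 * x.length + 1) ∧
    (x.foldl (scanStep (massStep φ)) (.start, ⟨[], [.bit true]⟩)).2.denom.length ≤
      1 + x.length * (2 * x.length + 1) := by
  induction x using List.reverseRecOn with
  | nil => simp
  | append_singleton x a ih =>
    have h₀ := length_foldl_scanStep (massStep φ) x (.start, ⟨[], [.bit true]⟩)
    rw [List.foldl_append]
    generalize x.foldl (scanStep (massStep φ)) (.start, ⟨[], [.bit true]⟩) = u at ih h₀
    obtain ⟨p, s⟩ := u
    simp only [Scan.length, Scan.start, List.length_nil, zero_add] at h₀ ih
    have hle : 1 + x.length * (2 * x.length + 1) + 2 * x.length + 1 ≤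
      1 + (x.length + 1) * (2 * (x.length + 1) + 1) := by nlinarith
    simp only [List.foldl_cons, List.foldl_nil, scanStep, List.length_append, List.length_singleton]
    unfold massStep
    split
    · have h₂ := length_mulStr p.den s.total
      have h₃ := length_mulStr p.den s.denom
      have h₄ := length_mulStr (bif evalInner p.text φ then p.numer else []) s.denom
      have h₅ : (bif evalInner p.text φ then p.numer else []).length ≤ p.numer.length := by
        cases evalInner p.text φ <;> simp
      simp only [length_addStr]
      constructor <;> omega
    · constructor <;> omega

theorem length_mass (θ φ : List Sym) :
    (mass θ φ).total.length ≤ 1 + θ.length * (2 * θ.length + 1) ∧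
    (mass θ φ).denom.length ≤ 1 + θ.length * (2 * θ.length + 1) :=
  length_foldl_massStep φ θ

/-- The comparison of two numbers. -/
def cmpStr : Cmp → List Sym → List Sym → Bool
  | .le, x, y => isZeroStr (subStr x y)
  | .lt, x, y => !isZeroStr (subStr y x)
  | .gt, x, y => !isZeroStr (subStr x y)
  | .ge, x, y => isZeroStr (subStr y x)

/-- The state when outer formulas are evaluated: a stack of values, and whether all formulas closed
by a comma had the value `1`. Values are numerators of fractions whose denominator is fixed. -/
structure OuterEval : Type where
  ok : Bool
  vals : List (List Sym)

/-- Replace the top value. -/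
def unaryOp (g : List Sym → List Sym) (v : List (List Sym)) : List (List Sym) :=
  g (v.headD []) :: v.tail

/-- Replace the top two values; the first argument is the value that was pushed first. -/
def binaryOp (g : List Sym → List Sym → List Sym) (v : List (List Sym)) : List (List Sym) :=
  g (v.tail.headD []) (v.headD []) :: v.tail.tail

/-- One step of the evaluation of outer formulas in the model described by the candidate `θ`, the
denominator of values being `D`. Truncated subtraction on numerators gives all connectives: for
instance `min 1 (x + y) = 1 - (1 - (x + y))`. -/
def outerStep (θ D : List Sym) (p : Scan) (s : OuterEval) (a : Sym) : OuterEval :=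
  match p.mode, a with
  | none, .pr => { s with vals := (mass θ p.text).total :: s.vals }
  | none, .neg => { s with vals := unaryOp (subStr D) s.vals }
  | none, .delta =>
    { s with vals := unaryOp (fun x => bif isZeroStr (subStr D x) then D else []) s.vals }
  | none, .odot => { s with vals := binaryOp (fun x y => subStr (addStr x y) D) s.vals }
  | none, .oplus => { s with vals := binaryOp (fun x y => subStr D (subStr D (addStr x y))) s.vals }
  | none, .imp => { s with vals := binaryOp (fun x y => subStr D (subStr x y)) s.vals }
  | none, .comma => ⟨isZeroStr (subStr D (s.vals.headD [])) && s.ok, s.vals.tail⟩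
  | some d, .close => { s with vals :=
      (bif cmpStr d (mulStr p.den (mass θ p.text).total) (mulStr p.numer D) then D else []) ::
        s.vals }
  | _, _ => s

/-- The evaluation of outer formulas. -/
def outerScan (θ D x : List Sym) (u : Scan × OuterEval) : Scan × OuterEval :=
  x.foldl (scanStep (outerStep θ D)) u

theorem size_unaryOp (g : List Sym → List Sym) (v : List (List Sym)) (k : ℕ)
    (hg : ∀ x, (g x).length ≤ x.length + k) : size (unaryOp g v) ≤ size v + k + 1 := by
  have := hg (v.headD [])
  cases v <;> simp [unaryOp] at * <;> omega

theorem size_binaryOp (g : List Sym → List Sym → List Sym) (v : List (List Sym)) (k : ℕ)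
    (hg : ∀ x y, (g x y).length ≤ x.length + y.length + k) :
    size (binaryOp g v) ≤ size v + k + 1 := by
  have := hg (v.tail.headD []) (v.headD [])
  rcases v with _ | ⟨x, _ | ⟨y, v⟩⟩ <;> simp [binaryOp] at * <;> omega

/-- At each step, the size of the stack of values grows by an amount that does not depend on the
values. -/
theorem size_outerStep (θ D : List Sym) (p : Scan) (s : OuterEval) (a : Sym) :
    size (outerStep θ D p s a).vals ≤
      size s.vals + (D.length + θ.length * (2 * θ.length + 1) + 3) := by
  unfold outerStep
  split
  · have := (length_mass θ p.text).1
    simp only [size_cons]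
    omega
  · dsimp only
    refine le_trans (b := size s.vals + D.length + 1) (size_unaryOp _ _ _ fun x => ?_) (by omega)
    exact (length_subStr D x).trans (by omega)
  · dsimp only
    refine le_trans (b := size s.vals + D.length + 1) (size_unaryOp _ _ _ fun x => ?_) (by omega)
    cases isZeroStr (subStr D x) <;> simp
  · dsimp only
    refine le_trans (b := size s.vals + (D.length + 1) + 1) (size_binaryOp _ _ _ fun x y => ?_)
      (by omega)
    have h₁ := length_subStr (addStr x y) D
    rw [length_addStr] at h₁
    omega
  · dsimp only
    refine le_trans (b := size s.vals + (D.length + 1) + 1) (size_binaryOp _ _ _ fun x y => ?_)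
      (by omega)
    have h₁ := length_subStr D (subStr D (addStr x y))
    have h₂ := length_subStr D (addStr x y)
    rw [length_addStr] at h₂
    omega
  · dsimp only
    refine le_trans (b := size s.vals + D.length + 1) (size_binaryOp _ _ _ fun x y => ?_) (by omega)
    have h₁ := length_subStr D (subStr x y)
    have h₂ := length_subStr x y
    omega
  · rcases s with ⟨b, _ | ⟨x, v⟩⟩ <;> simp
    omega
  · dsimp only
    generalize cmpStr _ _ _ = b
    cases b <;> simp <;> omega
  · omega

theorem size_foldl_outerStep (θ D x : List Sym) (u : Scan × OuterEval) :
    size (x.foldl (scanStep (outerStep θ D)) u).2.vals ≤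
      size u.2.vals + x.length * (D.length + θ.length * (2 * θ.length + 1) + 3) := by
  induction x generalizing u with
  | nil => simp
  | cons a x ih =>
    have h₁ := ih (scanStep (outerStep θ D) u a)
    have h₂ := size_outerStep θ D u.1 u.2 a
    simp only [List.foldl_cons, List.length_cons]
    simp only [scanStep] at h₁ ⊢
    nlinarith

namespace Feasible

section Rules

variable {ι : Type*} {f r : ι → List (List Sym)} {x y : ι → List Sym}

theorem massStep (a : Sym) {φ : ι → List Sym} {p : ι → Scan} {s : ι → Frac}
    (h : Feasible f (fun i => (p i).strings ((s i).total :: (s i).denom :: φ i :: r i))) :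
    Feasible f (fun i => (p i).strings ((massStep (φ i) (p i) (s i) a).total ::
      (massStep (φ i) (p i) (s i) a).denom :: φ i :: r i)) := by
  by_cases ha : a = .close
  · subst ha
    have h' := h.pick1
    refine h'.popMode (g := fun m i => (p i).strings
      ((FPAbduction.massStep (φ i) ⟨(p i).text, m, (p i).den, (p i).numer⟩ (s i) .close).total ::
      (FPAbduction.massStep (φ i) ⟨(p i).text, m, (p i).den, (p i).numer⟩ (s i) .close).denom ::
      φ i :: r i)) fun m => ?_
    by_cases hm : m = some .le
    · subst hm
      -- Decide whether the term entails `φ`, and put the numerator or the empty string on top.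
      have h₁ := (refl fun i => (p i).strings ((s i).total :: (s i).denom :: φ i :: r i)).dup
      have h₂ := (h₁.lift (refl _).pick6).evalInner
      have h₃ := h₂.popBit (g := fun b i => (bif b then (p i).numer else []) ::
        (p i).strings ((s i).total :: (s i).denom :: φ i :: r i)) fun b => by
          cases b
          · exact (refl _).nil
          · exact (refl _).pick3
      -- The new numerator, and then the new denominator on top of it.
      have h₄ := h₃.pick6.swap.mulStr
      have h₅ := h₄.pick5.pick4.mulStr.addStr
      have h₆ := h₅.pick6.pick4.mulStr
      -- Each of the two replaces the old string.
      exact h₆.sink ((refl _).sink ((refl _).sink ((refl _).sink ((refl _).sink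
        ((refl _).sink (refl _).nip))))) |>.sink ((refl _).sink
        ((refl _).sink ((refl _).sink (refl _).nip)))
    · refine (refl _).congr fun i => ?_
      have : ∀ p' : Scan, p'.mode = m → FPAbduction.massStep (φ i) p' (s i) .close = s i := by
        intro p' hp
        unfold FPAbduction.massStep
        split
        · next h₁ _ => exact absurd (hp.symm.trans h₁) hm
        · rfl
      rw [this _ rfl]
      rfl
  · exact h.congr fun i => by rw [massStep_of_ne ha]

theorem mass {φ θ : ι → List Sym} (h : Feasible f (fun i => φ i :: θ i :: r i)) :
    Feasible f (fun i => (mass (θ i) (φ i)).total :: (mass (θ i) (φ i)).denom :: r i) := by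
  refine (Feasible.scan (q := fun _ => ⟨[], [.bit true]⟩)
    (act := fun i => FPAbduction.massStep (φ i))
    (e := fun i s => s.total :: s.denom :: φ i :: r i)
    (h.swap.dip ((refl _).pushBit true).nil) (fun a => massStep a (refl _))
    (Polynomial.X + 2 * (1 + Polynomial.X * (2 * Polynomial.X + 1))) ?_).dip (refl _).nip
  intro i s hs
  have h₀ := hs.length_le
  obtain ⟨h₁, h₂⟩ := length_foldl_massStep (φ i) s
  simp only [Polynomial.eval_add, Polynomial.eval_mul, Polynomial.eval_X, Polynomial.eval_ofNat,
    Polynomial.eval_one]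
  have h₃ : s.length ≤ size (θ i :: [] :: [.bit true] :: φ i :: r i) := by simp; omega
  have h₄ : s.length * (2 * s.length + 1) ≤ size (θ i :: [] :: [.bit true] :: φ i :: r i) *
      (2 * size (θ i :: [] :: [.bit true] :: φ i :: r i) + 1) := by gcongr
  generalize size (θ i :: [] :: [.bit true] :: φ i :: r i) *
      (2 * size (θ i :: [] :: [.bit true] :: φ i :: r i) + 1) = K at h₄ ⊢
  simp only [size_cons, List.length_nil, List.length_singleton]
  omega

theorem cmpStr (d : Cmp) (h : Feasible f (fun i => x i :: y i :: r i)) :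
    Feasible f (fun i => [Sym.bit (cmpStr d (x i) (y i))] :: r i) := by
  cases d
  · exact h.subStr.isZeroStr
  · exact h.swap.subStr.isZeroStr.not
  · exact h.subStr.isZeroStr.not
  · exact h.swap.subStr.isZeroStr

/-- The probability of the inner formula read last, on top. -/
theorem massText {p : ι → Scan} {b D θ : ι → List Sym}
    (h : Feasible f (fun i => (p i).strings (b i :: D i :: θ i :: r i))) :
    Feasible f (fun i => (FPAbduction.mass (θ i) (p i).text).total ::
      (p i).strings (b i :: D i :: θ i :: r i)) :=
  h.dup.pick7.swap.mass.nip

/-- Transform the top value, given the denominator. -/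
theorem unary {p : ι → Scan} {b D θ : ι → List Sym} {v : ι → List (List Sym)}
    (h : Feasible f (fun i => (p i).strings (b i :: D i :: θ i :: v i)))
    (g : List Sym → List Sym → List Sym)
    (hg : Feasible (fun i : ι => D i :: (v i).headD [] :: (v i).tail)
      (fun i => g (D i) ((v i).headD []) :: (v i).tail)) :
    Feasible f (fun i => (p i).strings (b i :: D i :: θ i :: unaryOp (g (D i)) (v i))) :=
  h.pick5.bury7.dip7 (((refl fun i => D i :: v i).dip (refl _).ensure).trans hg)

/-- Transform the top two values, given the denominator. -/
theorem binary {p : ι → Scan} {b D θ : ι → List Sym} {v : ι → List (List Sym)}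
    (h : Feasible f (fun i => (p i).strings (b i :: D i :: θ i :: v i)))
    (g : List Sym → List Sym → List Sym → List Sym)
    (hg : Feasible (fun i : ι => D i :: (v i).tail.headD [] :: (v i).headD [] :: (v i).tail.tail)
      (fun i => g (D i) ((v i).tail.headD []) ((v i).headD []) :: (v i).tail.tail)) :
    Feasible f (fun i => (p i).strings (b i :: D i :: θ i :: binaryOp (g (D i)) (v i))) :=
  h.pick5.bury7.dip7 (((refl fun i => D i :: v i).dip
    ((refl _).ensure.dip (refl _).ensure).swap).trans hg)

theorem outerStep (a : Sym) {D θ : ι → List Sym} {p : ι → Scan} {s : ι → OuterEval}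
    (h : Feasible f (fun i => (p i).strings ([Sym.bit (s i).ok] :: D i :: θ i :: (s i).vals))) :
    Feasible f (fun i => (p i).strings ([Sym.bit (outerStep (θ i) (D i) (p i) (s i) a).ok] ::
      D i :: θ i :: (outerStep (θ i) (D i) (p i) (s i) a).vals)) := by
  have h' := h.pick1
  refine h'.popMode (g := fun m i => (p i).strings
    ([Sym.bit (FPAbduction.outerStep (θ i) (D i) ⟨(p i).text, m, (p i).den, (p i).numer⟩ (s i) a).ok]
      :: D i :: θ i ::
      (FPAbduction.outerStep (θ i) (D i) ⟨(p i).text, m, (p i).den, (p i).numer⟩ (s i) a).vals))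
    fun m => ?_
  have h₀ := refl fun i => (p i).strings ([Sym.bit (s i).ok] :: D i :: θ i :: (s i).vals)
  cases m with
  | none =>
    cases a
    case pr => exact h₀.massText.bury7
    case neg => exact h₀.unary FPAbduction.subStr (refl _).subStr
    case delta =>
      refine h₀.unary (fun D x => bif FPAbduction.isZeroStr (FPAbduction.subStr D x) then D else [])
        ?_
      exact ((refl _).dup.dip (refl _).subStr.isZeroStr).swap.popBit
        (g := fun b i => (bif b then D i else []) :: (s i).vals.tail) fun b => by
          cases b
          · exact (refl _).drop.nil
          · exact refl _
    case odot =>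
      exact h₀.binary (fun D x y => FPAbduction.subStr (FPAbduction.addStr x y) D)
        ((refl _).dip (refl _).addStr).swap.subStr
    case oplus =>
      exact h₀.binary
        (fun D x y => FPAbduction.subStr D (FPAbduction.subStr D (FPAbduction.addStr x y)))
        ((refl _).dup.dip ((refl _).dip (refl _).addStr).subStr).subStr
    case imp =>
      exact h₀.binary (fun D x y => FPAbduction.subStr D (FPAbduction.subStr x y))
        ((refl _).dip (refl _).subStr).subStr
    case comma =>
      -- Bring the top value to the front, where it is compared with the denominator.
      have h₁ := h₀.lift ((refl _).lift ((refl _).lift ((refl _).lift ((refl _).lift ((refl _).lift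
        ((refl _).lift (refl _).ensure))))))
      exact h₁.pick6.subStr.isZeroStr.bury4.dip4 (refl _).and
    all_goals exact h₀
  | some d =>
    by_cases ha : a = .close
    · subst ha
      -- `S / D ⋄ p / q` is decided as `S * q ⋄ p * D`.
      have h₁ := h₀.massText.pick3.mulStr.pick6.pick5.mulStr.swap
      have h₂ := (h₁.cmpStr d).popBit (g := fun b i => (bif b then D i else []) ::
        (p i).strings ([Sym.bit (s i).ok] :: D i :: θ i :: (s i).vals)) fun b => by
          cases b
          · exact (refl _).nil
          · exact (refl _).pick5
      exact h₂.bury7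
    · refine h₀.congr fun i => ?_
      have : FPAbduction.outerStep (θ i) (D i) ⟨(p i).text, some d, (p i).den, (p i).numer⟩ (s i) a =
          s i := by
        unfold FPAbduction.outerStep
        cases a <;> first | rfl | exact absurd rfl ha
      rw [this]

/-- Scanning a list of outer formulas is feasible. -/
theorem outerScan {x D θ : ι → List Sym} {s : ι → OuterEval}
    (h : Feasible f (fun i => x i :: [Sym.bit (s i).ok] :: D i :: θ i :: (s i).vals)) :
    Feasible f (fun i => [Sym.bit (outerScan (θ i) (D i) (x i) (.start, s i)).2.ok] :: D i :: θ i ::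
      (outerScan (θ i) (D i) (x i) (.start, s i)).2.vals) := by
  refine Feasible.scan (q := s) (act := fun i => FPAbduction.outerStep (θ i) (D i))
    (e := fun i s => [Sym.bit s.ok] :: D i :: θ i :: s.vals) h (fun a => outerStep a (refl _))
    (Polynomial.X + Polynomial.X * (Polynomial.X + Polynomial.X * (2 * Polynomial.X + 1) + 3)) ?_
  intro i t ht
  have h₀ := ht.length_le
  have h₁ := size_foldl_outerStep (θ i) (D i) t (.start, s i)
  simp only [Polynomial.eval_add, Polynomial.eval_mul, Polynomial.eval_X, Polynomial.eval_ofNat,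
    Polynomial.eval_one]
  have hn : size (x i :: [Sym.bit (s i).ok] :: D i :: θ i :: (s i).vals) =
    (x i).length + (D i).length + (θ i).length + size (s i).vals + 5 := by simp; omega
  rw [hn]
  have h₂ : t.length * ((D i).length + (θ i).length * (2 * (θ i).length + 1) + 3) ≤
      ((x i).length + (D i).length + (θ i).length + size (s i).vals + 5) *
      (((x i).length + (D i).length + (θ i).length + size (s i).vals + 5) +
      ((x i).length + (D i).length + (θ i).length + size (s i).vals + 5) *
      (2 * ((x i).length + (D i).length + (θ i).length + size (s i).vals + 5) + 1) + 3) := by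
    gcongr <;> omega
  simp only [size_cons, List.length_singleton]
  dsimp only at h₁
  omega

end Rules

end Feasible

/-! ### The decision procedure -/

/-- The letters as symbols, `Letter.hash` being the end marker. -/
def letterEquiv : Option Sym ≃ Letter where
  toFun
    | none => .hash
    | some (.bit b) => .bit b
    | some .var => .var
    | some .close => .close
    | some .slash => .slash
    | some .comma => .comma
    | some .ineg => .ineg
    | some .iand => .iand
    | some .ior => .ior
    | some .pr => .pr
    | some (.cmp d) => .cmp d
    | some .neg => .neg
    | some .delta => .delta
    | some .odot => .odot
    | some .oplus => .oplus
    | some .imp => .imp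
  invFun
    | .hash => none
    | .bit b => some (.bit b)
    | .var => some .var
    | .close => some .close
    | .slash => some .slash
    | .comma => some .comma
    | .ineg => some .ineg
    | .iand => some .iand
    | .ior => some .ior
    | .pr => some .pr
    | .cmp d => some (.cmp d)
    | .neg => some .neg
    | .delta => some .delta
    | .odot => some .odot
    | .oplus => some .oplus
    | .imp => some .imp
  left_inv o := by rcases o with _ | a <;> [rfl; cases a <;> rfl]
  right_inv a := by cases a <;> rfl

/-- Binary digits, least significant first. -/
def natStr (n : ℕ) : List Sym := n.bits.map Sym.bit

/-- Inner formulas as strings of symbols. -/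
def Inner.str : Inner → List Sym
  | .var p => .var :: (natStr p ++ [.close])
  | .neg φ => φ.str ++ [.ineg]
  | .and φ χ => φ.str ++ (χ.str ++ [.iand])
  | .or φ χ => φ.str ++ (χ.str ++ [.ior])

/-- The string of symbols following `Pr(φ)` in a comparison. -/
def cmpTail (d : Cmp) (c : Const) : List Sym :=
  .cmp d :: (natStr (c : ℚ).num.toNat ++ .slash :: (natStr (c : ℚ).den ++ [.close]))

/-- Outer formulas as strings of symbols. -/
def Outer.str : Outer → List Sym
  | .pr φ => φ.str ++ [.pr]
  | .cmp φ d c => φ.str ++ cmpTail d c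
  | .neg α => α.str ++ [.neg]
  | .delta α => α.str ++ [.delta]
  | .odot α β => α.str ++ (β.str ++ [.odot])
  | .oplus α β => α.str ++ (β.str ++ [.oplus])
  | .imp α β => α.str ++ (β.str ++ [.imp])

/-- The five strings between the end markers of an input. -/
def Input.strings (I : Input) : List (List Sym) :=
  [I.problem.theory.flatMap fun γ => γ.str ++ [.comma], I.problem.observation.str,
    I.problem.hypotheses.flatMap fun τ => τ.str ++ [.comma], natStr I.problem.n, I.candidate.str]

theorem map_natStr (n : ℕ) : (natStr n).map (fun a => letterEquiv (some a)) = binary n := by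
  simp [natStr, binary, letterEquiv]

theorem Inner.map_str (φ : Inner) : φ.str.map (fun a => letterEquiv (some a)) = φ.encode := by
  induction φ with
  | var p => simp [Inner.str, Inner.encode, map_natStr]; simp [letterEquiv]
  | neg φ ih => simp [Inner.str, Inner.encode, ih]; simp [letterEquiv]
  | and φ χ ih ih' => simp [Inner.str, Inner.encode, ih, ih']; simp [letterEquiv]
  | or φ χ ih ih' => simp [Inner.str, Inner.encode, ih, ih']; simp [letterEquiv]

theorem Outer.map_str (α : Outer) : α.str.map (fun a => letterEquiv (some a)) = α.encode := by
  induction α with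
  | pr φ => simp [Outer.str, Outer.encode, Inner.map_str]; simp [letterEquiv]
  | cmp φ d c =>
    simp [Outer.str, Outer.encode, Inner.map_str, cmpTail, encodeConst, map_natStr]
    simp [letterEquiv]
  | neg α ih => simp [Outer.str, Outer.encode, ih]; simp [letterEquiv]
  | delta α ih => simp [Outer.str, Outer.encode, ih]; simp [letterEquiv]
  | odot α β ih ih' => simp [Outer.str, Outer.encode, ih, ih']; simp [letterEquiv]
  | oplus α β ih ih' => simp [Outer.str, Outer.encode, ih, ih']; simp [letterEquiv]
  | imp α β ih ih' => simp [Outer.str, Outer.encode, ih, ih']; simp [letterEquiv]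

theorem Input.encode_eq (I : Input) : I.encode = (flatOpen I.strings).map letterEquiv := by
  have h₁ : letterEquiv none = .hash := rfl
  have h₂ : letterEquiv (some .comma) = .comma := rfl
  simp only [Input.encode, Problem.encode, Input.strings, flatOpen, onTop, List.map_append,
    List.map_cons, List.map_map, h₁, List.map_flatMap, Function.comp_def, Inner.map_str,
    Outer.map_str, map_natStr, List.map_nil, h₂]
  simp

/-- The common denominator of all values. -/
def denomStr (θ : List Sym) : List Sym := (mass θ []).denom

/-- The evaluation of the theory, given as the string `g` of formulas closed by commas, and of the
observation `d`, in the model described by the candidate `θ`. -/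
def verdict (g d θ : List Sym) : OuterEval :=
  (outerScan θ (denomStr θ) (g ++ (d ++ [.comma])) (.start, ⟨true, []⟩)).2

/-- The procedure as a feasible transformation; it remains to remove what it leaves behind. -/
theorem feasible_verdict {ι : Type*} (g d h n θ : ι → List Sym) :
    Feasible (fun i => [g i, d i, h i, n i, θ i]) (fun i =>
      [Sym.bit (verdict (g i) (d i) (θ i)).ok] :: (verdict (g i) (d i) (θ i)).vals) := by
  have h₁ := (((Feasible.refl fun i => [g i, d i, h i, n i, θ i]).dip
    ((Feasible.refl _).concat .comma)).append.nip.nip)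
  have h₂ := h₁.dip ((Feasible.refl _).dup.nil.mass.drop.pushBit true)
  exact (h₂.outerScan (s := fun _ => ⟨true, []⟩)).nip.nip

/-! ### Correctness of scanning -/

theorem isInner_str (φ : Inner) : ∀ a ∈ φ.str, a.isInner = true := by
  have hn : ∀ n, ∀ a ∈ natStr n, a.isInner = true := by
    intro n a ha
    obtain ⟨b, -, rfl⟩ := List.mem_map.1 ha
    rfl
  induction φ with
  | var p =>
    intro a ha
    simp only [Inner.str, List.mem_cons, List.mem_append, List.not_mem_nil, or_false] at ha
    rcases ha with rfl | ha | rfl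
    · rfl
    · exact hn p a ha
    · rfl
  | neg φ ih =>
    intro a ha
    simp only [Inner.str, List.mem_cons, List.mem_append, List.not_mem_nil, or_false] at ha
    rcases ha with ha | rfl
    · exact ih a ha
    · rfl
  | and φ χ ih ih' | or φ χ ih ih' =>
    intro a ha
    simp only [Inner.str, List.mem_cons, List.mem_append, List.not_mem_nil, or_false] at ha
    rcases ha with ha | ha | rfl
    · exact ih a ha
    · exact ih' a ha
    · rfl

/-- An action is passive if it happens only at the end of an atomic formula or at a connective. -/
def Passive {σ : Type*} (act : Scan → σ → Sym → σ) : Prop :=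
  (∀ p s a, p.mode = none → a.isInner = true → act p s a = s) ∧
  (∀ p s d, p.mode = none → act p s (.cmp d) = s) ∧
  ∀ p s a, p.mode ≠ none → a ≠ .close → act p s a = s

section Scanning

variable {σ : Type*} {act : Scan → σ → Sym → σ}

/-- Inner formulas are gathered without any action. -/
theorem foldl_scanStep_inner (hact : Passive act) (x : List Sym) (hx : ∀ a ∈ x, a.isInner = true)
    (t d n : List Sym) (s : σ) :
    x.foldl (scanStep act) (⟨t, none, d, n⟩, s) = (⟨t ++ x, none, d, n⟩, s) := by
  induction x generalizing t with
  | nil => simp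
  | cons a x ih =>
    have ha := hx a (by simp)
    have : scanStep act (⟨t, none, d, n⟩, s) a = (⟨t ++ [a], none, d, n⟩, s) := by
      rw [scanStep, hact.1 _ _ _ rfl ha]
      cases a <;> first | rfl | simp [Sym.isInner] at ha
    rw [List.foldl_cons, this, ih fun b hb => hx b (by simp [hb])]
    simp

theorem foldl_scanStep_natStr (hact : Passive act) (m : ℕ) (t d n : List Sym) (c : Cmp) (s : σ) :
    (natStr m).foldl (scanStep act) (⟨t, some c, d, n⟩, s) =
      (⟨t, some c, d ++ natStr m, n⟩, s) := by
  unfold natStr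
  induction m.bits generalizing d with
  | nil => simp
  | cons b l ih =>
    rw [List.map_cons, List.foldl_cons, scanStep, hact.2.2 _ _ _ (by simp) (by simp)]
    exact (ih _).trans (by simp)

theorem foldl_scanStep_cmp (hact : Passive act) (φ : Inner) (d : Cmp) (c : Const) (s : σ) :
    (Outer.cmp φ d c).str.foldl (scanStep act) (.start, s) =
      (.start, act ⟨φ.str, some d, natStr (c : ℚ).den, natStr (c : ℚ).num.toNat⟩ s .close) := by
  have h₁ : scanStep act (⟨φ.str, none, [], []⟩, s) (.cmp d) = (⟨φ.str, some d, [], []⟩, s) := by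
    rw [scanStep, hact.2.1 _ _ _ rfl]
    rfl
  have h₂ : ∀ m, scanStep act (⟨φ.str, some d, m, []⟩, s) .slash = (⟨φ.str, some d, [], m⟩, s) := by
    intro m
    rw [scanStep, hact.2.2 _ _ _ (by simp) (by simp)]
    rfl
  simp only [Outer.str, cmpTail, List.foldl_append, List.foldl_cons, List.foldl_nil, Scan.start,
    foldl_scanStep_inner hact _ (isInner_str φ), List.nil_append, h₁, foldl_scanStep_natStr hact, h₂]
  rfl

theorem foldl_scanStep_pr (hact : Passive act) (φ : Inner) (s : σ) :
    (Outer.pr φ).str.foldl (scanStep act) (.start, s) =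
      (.start, act ⟨φ.str, none, [], []⟩ s .pr) := by
  simp only [Outer.str, List.foldl_append, List.foldl_cons, List.foldl_nil, Scan.start]
  rw [foldl_scanStep_inner hact _ (isInner_str φ)]
  simp [scanStep, Scan.next]

end Scanning

theorem passive_massStep (φ : List Sym) : Passive (massStep φ) := by
  refine ⟨fun p s a hp _ => ?_, fun p s d _ => ?_, fun p s a _ ha => massStep_of_ne ha _ _ _⟩
  · unfold massStep
    rw [hp]
  · exact massStep_of_ne (by simp) _ _ _

theorem passive_outerStep (θ D : List Sym) : Passive (outerStep θ D) := by
  refine ⟨fun p s a hp ha => ?_, fun p s d hp => ?_, fun p s a hp ha => ?_⟩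
  · unfold outerStep
    rw [hp]
    cases a <;> first | rfl | simp [Sym.isInner] at ha
  · unfold outerStep
    rw [hp]
  · obtain ⟨d, hd⟩ := Option.ne_none_iff_exists'.1 hp
    unfold outerStep
    rw [hd]
    cases a <;> first | rfl | exact absurd rfl ha

/-! ### Correctness of the evaluation of inner formulas -/

theorem num_natStr (n : ℕ) : num (natStr n) = n := num_bits n

theorem foldl_lookupStep_natStr (key : List Sym) (n : ℕ) (s : Lookup) :
    (natStr n).foldl (lookupStep key) s = { s with cur := s.cur ++ natStr n } := by
  unfold natStr
  induction n.bits generalizing s with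
  | nil => simp
  | cons b l ih => simp [ih, lookupStep]

theorem foldl_lookupStep_var (key : List Sym) (p : ℕ) (s : Lookup) :
    (Inner.var p).str.foldl (lookupStep key) s =
      ⟨natStr p, decide (p = num key), s.val || decide (p = num key)⟩ := by
  simp [Inner.str, lookupStep, foldl_lookupStep_natStr, eqStr_eq, num_natStr]

open scoped Classical in
/-- In the only state that satisfies a term, a variable of the term is true if and only if it is
found to be true. -/
theorem val_foldl_lookupStep {V : Finset ℕ} (key : List Sym) (τ : Inner) (hτ : τ.IsTerm)
    (X : State V) (hX : X ∈ truthSet V τ) (s : Lookup) :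
    (τ.str.foldl (lookupStep key) s).val =
      if num key ∈ τ.vars then decide (num key ∈ X.1) else s.val := by
  induction τ generalizing s with
  | var p =>
    rw [foldl_lookupStep_var]
    have : p ∈ X.1 := hX
    by_cases h : p = num key
    · subst h; simp [Inner.vars, this]
    · simp [Inner.vars, h, Ne.symm h]
  | neg φ ih =>
    cases φ with
    | var p =>
      have : p ∉ X.1 := hX
      have hs : (Inner.neg (.var p)).str = (Inner.var p).str ++ [.ineg] := rfl
      rw [hs, List.foldl_append, foldl_lookupStep_var]
      by_cases h : p = num key
      · subst h; simp [Inner.vars, this, lookupStep]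
      · simp [Inner.vars, h, Ne.symm h, lookupStep]
    | _ => exact hτ.elim
  | and φ χ ih ih' =>
    simp only [Inner.str, List.foldl_append, List.foldl_cons, List.foldl_nil, lookupStep]
    rw [ih' hτ.2 hX.2, ih hτ.1 hX.1]
    by_cases h : num key ∈ χ.vars <;> simp [Inner.vars, h]
  | or φ χ ih ih' => exact hτ.elim

open scoped Classical in
/-- Evaluating an inner formula pushes its truth value. -/
theorem vals_foldl_evalStep {V : Finset ℕ} {τ : Inner} (hτ : τ.IsTerm) (hV : τ.vars = V)
    {X : State V} (hX : X ∈ truthSet V τ) (φ : Inner) (hφ : φ.vars ⊆ V) (s : Eval) :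
    (φ.str.foldl (evalStep τ.str) s).vals = .bit (decide (X ∈ truthSet V φ)) :: s.vals := by
  induction φ generalizing s with
  | var p =>
    have h : ∀ (l : List Bool) (s : Eval), (l.map Sym.bit).foldl (evalStep τ.str) s =
        { s with cur := s.cur ++ l.map Sym.bit } := by
      intro l
      induction l with
      | nil => simp
      | cons b l ih => intro s; simp [ih, evalStep]
    have hp : p ∈ τ.vars := hV ▸ hφ (by simp [Inner.vars])
    simp only [Inner.str, natStr, List.foldl_cons, List.foldl_append, List.foldl_nil, h, evalStep,
      List.nil_append]
    rw [lookup, val_foldl_lookupStep _ τ hτ X hX, num_bits, if_pos hp]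
    exact congrArg (fun b => Sym.bit b :: s.vals) (decide_eq_decide.2 Iff.rfl)
  | neg φ ih =>
    simp only [Inner.str, List.foldl_cons, List.foldl_append, List.foldl_nil, evalStep]
    rw [ih hφ]
    simp [truthSet]
  | and φ χ ih ih' =>
    simp only [Inner.str, List.foldl_cons, List.foldl_append, List.foldl_nil, evalStep]
    rw [ih' (Finset.union_subset_right hφ), ih (Finset.union_subset_left hφ)]
    simp [truthSet, Bool.and_comm]
  | or φ χ ih ih' =>
    simp only [Inner.str, List.foldl_cons, List.foldl_append, List.foldl_nil, evalStep]
    rw [ih' (Finset.union_subset_right hφ), ih (Finset.union_subset_left hφ)]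
    simp [truthSet, Bool.or_comm]

theorem evalInner_eq_true_iff {V : Finset ℕ} {τ : Inner} (hτ : τ.IsTerm) (hV : τ.vars = V)
    {X : State V} (hX : X ∈ truthSet V τ) {φ : Inner} (hφ : φ.vars ⊆ V) :
    evalInner τ.str φ.str = true ↔ X ∈ truthSet V φ := by
  rw [evalInner, vals_foldl_evalStep hτ hV hX φ hφ]
  simp

/-! ### The model described by a complete interval term -/

/-- Models are equal if they agree on all sets of states. -/
theorem Model.ext' {V : Finset ℕ} {M N : Model V} (h : ∀ B, M.μ B = N.μ B) : M = N := by
  obtain ⟨μ, _, _, _, _⟩ := M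
  obtain ⟨ν, _, _, _, _⟩ := N
  obtain rfl : μ = ν := funext h
  rfl

theorem ite_one_zero_eq_one {p : Prop} [Decidable p] : (if p then (1 : ℝ) else 0) = 1 ↔ p := by
  split_ifs with h <;> simp [h]

theorem Model.value_mem_Icc {V : Finset ℕ} (M : Model V) (α : Outer) :
    M.value α ∈ Set.Icc (0 : ℝ) 1 := by
  induction α with
  | pr φ => exact M.mem_Icc _
  | cmp φ d c => unfold Model.value; split_ifs <;> simp
  | neg α ih => obtain ⟨h₁, h₂⟩ := ih; unfold Model.value; constructor <;> linarith
  | delta α ih => unfold Model.value; split_ifs <;> simp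
  | odot α β ih ih' =>
    obtain ⟨h₁, h₂⟩ := ih; obtain ⟨h₃, h₄⟩ := ih'
    unfold Model.value
    exact ⟨le_max_left _ _, max_le zero_le_one (by linarith)⟩
  | oplus α β ih ih' =>
    obtain ⟨h₁, h₂⟩ := ih; obtain ⟨h₃, h₄⟩ := ih'
    unfold Model.value
    exact ⟨le_min zero_le_one (by linarith), min_le_left _ _⟩
  | imp α β ih ih' =>
    obtain ⟨h₁, h₂⟩ := ih; obtain ⟨h₃, h₄⟩ := ih'
    unfold Model.value
    exact ⟨le_min zero_le_one (by linarith), min_le_left _ _⟩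

theorem Model.value_eq_one_iff {V : Finset ℕ} (M : Model V) (θ : Outer) :
    M.value θ = 1 ↔ ∀ α ∈ θ.conjuncts, M.value α = 1 := by
  induction θ with
  | odot α β ih ih' =>
    obtain ⟨-, h₂⟩ := M.value_mem_Icc α
    obtain ⟨-, h₄⟩ := M.value_mem_Icc β
    simp only [Outer.conjuncts, List.mem_append, or_imp, forall_and, ← ih, ← ih']
    simp only [Model.value]
    constructor
    · intro h
      rcases max_choice 0 (M.value α + M.value β - 1) with h' | h' <;> rw [h'] at h
      · exact absurd h (by norm_num)
      · constructor <;> linarith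
    · rintro ⟨h, h'⟩
      rw [h, h']; norm_num
  | _ => simp [Outer.conjuncts]

theorem mem_vars_iff (θ : Outer) (p : ℕ) : p ∈ θ.vars ↔ ∃ α ∈ θ.conjuncts, p ∈ α.vars := by
  induction θ with
  | odot α β ih ih' =>
    simp only [Outer.vars, Outer.conjuncts, Finset.mem_union, ih, ih', List.mem_append, or_and_right,
      exists_or]
  | _ => simp [Outer.conjuncts]

/-- A term over all variables is satisfied by at most one state. -/
theorem subsingleton_truthSet {V : Finset ℕ} {τ : Inner} (hτ : τ.IsTerm) (hV : τ.vars = V) :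
    (truthSet V τ).Subsingleton := by
  classical
  intro X hX Y hY
  refine Subtype.ext (Finset.ext fun p => ?_)
  by_cases hp : p ∈ V
  · have h₁ := val_foldl_lookupStep (natStr p) τ hτ X hX ⟨[], false, false⟩
    have h₂ := val_foldl_lookupStep (natStr p) τ hτ Y hY ⟨[], false, false⟩
    rw [num_natStr, if_pos (hV ▸ hp)] at h₁ h₂
    exact decide_eq_decide.1 (h₁.symm.trans h₂)
  · exact iff_of_false (fun h => hp (X.2 h)) (fun h => hp (Y.2 h))

section Weights

variable {V : Finset ℕ} {L : List (Inner × Const)}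

open scoped Classical in
/-- The sum of the `cᵢ` over all `i` such that the states satisfying `τᵢ` belong to `B`. -/
noncomputable def massOn (V : Finset ℕ) (L : List (Inner × Const)) (B : Set (State V)) : ℝ :=
  (L.map (fun q => if truthSet V q.1 ⊆ B then ((q.2 : ℚ) : ℝ) else 0)).sum

theorem massOn_cons (q : Inner × Const) (L : List (Inner × Const)) (B : Set (State V))
    [Decidable (truthSet V q.1 ⊆ B)] : massOn V (q :: L) B =
      (if truthSet V q.1 ⊆ B then ((q.2 : ℚ) : ℝ) else 0) + massOn V L B := by
  simp only [massOn, List.map_cons, List.sum_cons]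
  congr

/-- Every term in the list describes exactly one state. -/
def Describes (V : Finset ℕ) (L : List (Inner × Const)) : Prop :=
  ∀ q ∈ L, ∃ X, truthSet V q.1 = {X}

theorem IsCompleteWith.describes {n : ℕ} {θ : Outer} (h : IsCompleteWith V n L θ) :
    Describes V L := by
  intro q hq
  obtain ⟨X, hX⟩ := h.satisfiable q hq
  exact ⟨X, (subsingleton_truthSet (h.isTerm q hq) (h.vars_eq q hq)).eq_singleton_of_mem hX⟩

theorem const_nonneg (c : Const) : (0 : ℝ) ≤ ((c : ℚ) : ℝ) := by exact_mod_cast c.2.1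

theorem massOn_nonneg (B : Set (State V)) : 0 ≤ massOn V L B := by
  classical
  induction L with
  | nil => simp [massOn]
  | cons q L ih =>
    rw [massOn_cons]
    have := const_nonneg q.2
    split_ifs <;> linarith

theorem massOn_union (h : Describes V L) {B C : Set (State V)} (hBC : B ∩ C = ∅) :
    massOn V L (B ∪ C) = massOn V L B + massOn V L C := by
  classical
  induction L with
  | nil => simp [massOn]
  | cons q L ih =>
    obtain ⟨X, hX⟩ := h q (by simp)
    rw [massOn_cons, massOn_cons, massOn_cons, ih fun r hr => h r (by simp [hr]), hX]
    simp only [Set.singleton_subset_iff, Set.mem_union]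
    by_cases hB : X ∈ B <;> by_cases hC : X ∈ C
    · exact absurd (show X ∈ B ∩ C from ⟨hB, hC⟩) (by simp [hBC])
    all_goals simp [hB, hC]
    all_goals ring

theorem massOn_univ (L : List (Inner × Const)) :
    massOn V L Set.univ = (((L.map fun q => (q.2 : ℚ)).sum : ℚ) : ℝ) := by
  classical
  induction L with
  | nil => simp [massOn]
  | cons q L ih => rw [massOn_cons, ih]; simp

theorem massOn_empty (h : Describes V L) : massOn V L ∅ = 0 := by
  have := massOn_union h (B := ∅) (C := ∅) (by simp)
  rw [Set.union_empty] at this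
  linarith

theorem massOn_eq_zero (h : Describes V L) {X : State V}
    (hL : ∀ q ∈ L, truthSet V q.1 ≠ {X}) : massOn V L {X} = 0 := by
  classical
  induction L with
  | nil => simp [massOn]
  | cons q L ih =>
    obtain ⟨Y, hY⟩ := h q (by simp)
    have hne := hL q (by simp)
    rw [massOn_cons, ih (fun r hr => h r (by simp [hr])) (fun r hr => hL r (by simp [hr])), hY]
    have : Y ≠ X := fun hYX => hne (hYX ▸ hY)
    simp [this]

theorem massOn_truthSet (h : Describes V L)
    (hL : L.Pairwise fun q r => truthSet V q.1 ≠ truthSet V r.1) {q : Inner × Const} (hq : q ∈ L) :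
    massOn V L (truthSet V q.1) = ((q.2 : ℚ) : ℝ) := by
  classical
  induction L with
  | nil => simp at hq
  | cons r L ih =>
    have h' : Describes V L := fun s hs => h s (by simp [hs])
    rw [List.pairwise_cons] at hL
    rw [massOn_cons]
    rcases List.mem_cons.1 hq with rfl | hq
    · obtain ⟨X, hX⟩ := h q (by simp)
      rw [if_pos subset_rfl, hX, massOn_eq_zero h' fun s hs => hX ▸ (hL.1 s hs).symm, add_zero]
    · obtain ⟨X, hX⟩ := h r (by simp)
      obtain ⟨Y, hY⟩ := h' q hq
      have hne := hL.1 q hq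
      rw [ih h' hL.2 hq, if_neg, zero_add]
      rw [hX, hY] at hne ⊢
      simpa using hne

/-- By finite additivity, a model gives every set at least the sum of the weights of the described
states in it. -/
theorem massOn_le (h : Describes V L)
    (hL : L.Pairwise fun q r => truthSet V q.1 ≠ truthSet V r.1) (M : Model V)
    (hM : ∀ q ∈ L, M.μ (truthSet V q.1) = ((q.2 : ℚ) : ℝ)) (B : Set (State V)) :
    massOn V L B ≤ M.μ B := by
  classical
  induction L generalizing B with
  | nil => exact (M.mem_Icc B).1
  | cons q L ih =>
    have h' : Describes V L := fun s hs => h s (by simp [hs])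
    rw [List.pairwise_cons] at hL
    have ih' := ih h' hL.2 (fun s hs => hM s (by simp [hs]))
    obtain ⟨X, hX⟩ := h q (by simp)
    rw [massOn_cons]
    split_ifs with hB
    · have h₁ : M.μ B = M.μ (truthSet V q.1) + M.μ (B \ truthSet V q.1) := by
        rw [← M.union _ _ (by simp), Set.union_sdiff_cancel hB]
      have h₂ : massOn V L B = massOn V L (B \ truthSet V q.1) := by
        have h₃ := massOn_union h' (B := truthSet V q.1) (C := B \ truthSet V q.1) (by simp)
        rw [Set.union_sdiff_cancel hB] at h₃
        rw [h₃, hX, massOn_eq_zero h' fun s hs => hX ▸ (hL.1 s hs).symm, zero_add]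
      rw [h₁, h₂, hM q (by simp)]
      exact add_le_add_right (ih' _) _
    · rw [zero_add]
      exact ih' B

variable {n : ℕ} {θ : Outer}

/-- A model gives a complete interval term the value `1` if and only if it gives the described
states their weights. -/
theorem IsCompleteWith.value_eq_one_iff (h : IsCompleteWith V n L θ) (M : Model V) :
    M.value θ = 1 ↔ ∀ q ∈ L, M.μ (truthSet V q.1) = ((q.2 : ℚ) : ℝ) := by
  rw [M.value_eq_one_iff]
  simp only [h.conjuncts_perm.mem_iff, List.mem_append, List.mem_map]
  constructor
  · intro hM q hq
    have h₁ := hM _ (Or.inl ⟨q, hq, rfl⟩)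
    have h₂ := hM _ (Or.inr ⟨q, hq, rfl⟩)
    simp only [Model.value, ite_one_zero_eq_one] at h₁ h₂
    exact le_antisymm h₁ h₂
  · rintro hM α (⟨q, hq, rfl⟩ | ⟨q, hq, rfl⟩) <;> simp [Model.value, Cmp.Holds, hM q hq]

/-- The model described by a complete interval term. -/
noncomputable def IsCompleteWith.model (h : IsCompleteWith V n L θ) : Model V where
  μ := massOn V L
  mem_Icc B := by
    refine ⟨massOn_nonneg B, ?_⟩
    have h₁ := massOn_union h.describes (B := B) (C := Bᶜ) (by simp)
    rw [Set.union_compl_self, massOn_univ, h.sum_eq_one] at h₁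
    have := massOn_nonneg (L := L) Bᶜ
    push_cast at h₁
    linarith
  univ := by rw [massOn_univ, h.sum_eq_one]; simp
  empty := massOn_empty h.describes
  union _ _ := massOn_union h.describes

theorem IsCompleteWith.value_model (h : IsCompleteWith V n L θ) : h.model.value θ = 1 :=
  (h.value_eq_one_iff _).2 fun _ hq => massOn_truthSet h.describes h.inequivalent hq

theorem IsCompleteWith.eq_model (h : IsCompleteWith V n L θ) {M : Model V} (hM : M.value θ = 1) :
    M = h.model := by
  refine Model.ext' fun B => ?_
  have hle := massOn_le h.describes h.inequivalent M ((h.value_eq_one_iff M).1 hM)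
  have h₁ := hle B
  have h₂ := hle Bᶜ
  have h₃ := M.union B Bᶜ (by simp)
  have h₄ := massOn_union h.describes (B := B) (C := Bᶜ) (by simp)
  rw [Set.union_compl_self, M.univ] at h₃
  rw [Set.union_compl_self, massOn_univ, h.sum_eq_one] at h₄
  push_cast at h₄
  change M.μ B = massOn V L B
  linarith

theorem IsCompleteWith.vars_eq_vars (h : IsCompleteWith V n L θ) : θ.vars = V := by
  ext p
  rw [mem_vars_iff]
  simp only [h.conjuncts_perm.mem_iff, List.mem_append, List.mem_map]
  constructor
  · rintro ⟨α, ⟨q, hq, rfl⟩ | ⟨q, hq, rfl⟩, hp⟩ <;> exact h.vars_eq q hq ▸ hp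
  · intro hp
    obtain ⟨q, hq⟩ := List.exists_mem_of_ne_nil L fun hL => by
      have := h.sum_eq_one
      simp [hL] at this
    exact ⟨_, Or.inl ⟨q, hq, rfl⟩, show p ∈ q.1.vars by rwa [h.vars_eq q hq]⟩

end Weights

theorem outerVars_le {Γ : List Outer} {γ : Outer} (h : γ ∈ Γ) : γ.vars ⊆ outerVars Γ := by
  induction Γ with
  | nil => simp at h
  | cons α Γ ih =>
    rcases List.mem_cons.1 h with rfl | h
    · exact Finset.subset_union_left
    · exact (ih h).trans Finset.subset_union_right

/-- A complete interval term is a full solution if and only if its model gives the theory and the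
observation the value `1`. -/
theorem isFullSolution_iff {P : Problem} {θ : Outer} {L : List (Inner × Const)}
    (h : IsCompleteWith P.vars P.n L θ) : IsFullSolution P θ ↔
      (∀ γ ∈ P.theory, h.model.value γ = 1) ∧ h.model.value P.observation = 1 := by
  have hθ := h.vars_eq_vars
  have h₁ : outerVars (P.observation :: θ :: P.theory) = P.vars := by
    simp only [outerVars, hθ, Problem.vars]
    ext p
    simp only [Finset.mem_union]
    tauto
  have h₂ : outerVars (θ :: P.theory) = P.vars := by
    simp only [outerVars, hθ, Problem.vars]
    ext p
    simp only [Finset.mem_union]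
    tauto
  have key₁ : ∀ W, W = P.vars → ((∀ M : Model W, (∀ γ ∈ θ :: P.theory, M.value γ = 1) →
      M.value P.observation = 1) ↔
      ((∀ γ ∈ P.theory, h.model.value γ = 1) → h.model.value P.observation = 1)) := by
    rintro _ rfl
    constructor
    · intro hM hΓ
      exact hM _ (List.forall_mem_cons.2 ⟨h.value_model, hΓ⟩)
    · intro hM M hΓ
      rw [List.forall_mem_cons] at hΓ
      obtain rfl := h.eq_model hΓ.1
      exact hM hΓ.2
  have key₂ : ∀ W, W = P.vars → ((∀ M : Model W, ¬ ∀ γ ∈ θ :: P.theory, M.value γ = 1) ↔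
      ¬ ∀ γ ∈ P.theory, h.model.value γ = 1) := by
    rintro _ rfl
    constructor
    · intro hM hΓ
      exact hM _ (List.forall_mem_cons.2 ⟨h.value_model, hΓ⟩)
    · intro hM M hΓ
      rw [List.forall_mem_cons] at hΓ
      obtain rfl := h.eq_model hΓ.1
      exact hM hΓ.2
  rw [IsFullSolution, ConsEntails, Entails, EntailsFalsum, key₁ _ h₁, key₂ _ h₂, not_not]
  exact ⟨fun hs => ⟨hs.2.2, hs.2.1 hs.2.2⟩, fun hs => ⟨⟨L, h⟩, fun _ => hs.2, hs.1⟩⟩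

/-! ### Correctness of the decision procedure -/

/-- The denominator does not depend on the formula whose probability is computed. -/
theorem denom_foldl_massStep (φ χ x : List Sym) (p : Scan) (s t : Frac) (h : s.denom = t.denom) :
    (x.foldl (scanStep (massStep φ)) (p, s)).2.denom =
      (x.foldl (scanStep (massStep χ)) (p, t)).2.denom := by
  induction x generalizing p s t with
  | nil => exact h
  | cons a x ih =>
    refine ih _ _ _ ?_
    dsimp only
    unfold massStep
    split <;> simp [h]

theorem denom_mass (θ φ : List Sym) : (mass θ φ).denom = denomStr θ :=
  denom_foldl_massStep φ [] θ _ _ _ rfl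

/-- The contribution of a conjunct of the candidate to the probability of `φ`. -/
noncomputable def weight (φ : List Sym) : Outer → ℝ
  | .cmp τ .le c => bif evalInner τ.str φ then ((c : ℚ) : ℝ) else 0
  | _ => 0

theorem const_eq_div (c : Const) :
    ((c : ℚ) : ℝ) = ((c : ℚ).num.toNat : ℝ) / ((c : ℚ).den : ℝ) := by
  have h : (((c : ℚ).num.toNat : ℤ) : ℝ) = ((c : ℚ).num : ℝ) := by
    rw [Int.toNat_of_nonneg (Rat.num_nonneg.2 c.2.1)]
  rw [Int.cast_natCast] at h
  rw [h]
  exact Rat.cast_def _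

/-- Scanning a candidate adds the contributions of its conjuncts. -/
theorem exists_foldl_massStep (φ : List Sym) (θ : Outer)
    (hθ : ∀ α ∈ θ.conjuncts, ∃ τ d c, α = .cmp τ d c) (s : Frac) (hs : 0 < num s.denom) :
    ∃ s', θ.str.foldl (scanStep (massStep φ)) (.start, s) = (.start, s') ∧ 0 < num s'.denom ∧
      (num s'.total : ℝ) / num s'.denom =
        num s.total / num s.denom + (θ.conjuncts.map (weight φ)).sum := by
  induction θ generalizing s with
  | odot α β ih ih' =>
    simp only [Outer.conjuncts, List.mem_append, or_imp, forall_and] at hθ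
    obtain ⟨s₁, h₁, hs₁, e₁⟩ := ih hθ.1 s hs
    obtain ⟨s₂, h₂, hs₂, e₂⟩ := ih' hθ.2 s₁ hs₁
    refine ⟨s₂, ?_, hs₂, ?_⟩
    · simp only [Outer.str, List.foldl_append, h₁, h₂]
      rfl
    · rw [e₂, e₁, Outer.conjuncts, List.map_append, List.sum_append, add_assoc]
  | cmp τ d c =>
    rw [foldl_scanStep_cmp (passive_massStep φ)]
    refine ⟨_, rfl, ?_⟩
    simp only [Outer.conjuncts, List.map_cons, List.map_nil, List.sum_singleton]
    cases d
    case le =>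
      have hd : (0 : ℝ) < (c : ℚ).den := by exact_mod_cast (c : ℚ).den_pos
      have hn : (0 : ℝ) < num s.denom := by exact_mod_cast hs
      simp only [massStep, num_mulStr, num_addStr, num_natStr, weight]
      refine ⟨Nat.mul_pos (c : ℚ).den_pos hs, ?_⟩
      rw [const_eq_div]
      push_cast
      cases evalInner τ.str φ
      · simp only [cond_false, num_nil]
        field_simp
        simp
      · simp only [cond_true, num_natStr]
        field_simp
    all_goals exact ⟨hs, by simp [massStep, weight]⟩
  | _ =>
    obtain ⟨τ, d, c, h⟩ := hθ _ (List.mem_singleton_self _)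
    cases h

section Verdict

variable {V : Finset ℕ} {n : ℕ} {L : List (Inner × Const)} {θ : Outer}

theorem denomStr_pos (h : IsCompleteWith V n L θ) : 0 < num (denomStr θ.str) := by
  obtain ⟨s, h₁, h₂, -⟩ := exists_foldl_massStep [] θ (fun α hα => by
    rw [h.conjuncts_perm.mem_iff] at hα
    simp only [List.mem_append, List.mem_map] at hα
    rcases hα with ⟨q, -, rfl⟩ | ⟨q, -, rfl⟩ <;> exact ⟨_, _, _, rfl⟩) ⟨[], [.bit true]⟩ (by simp)
  rw [denomStr, mass, h₁]
  exact h₂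

theorem sum_weight (h : IsCompleteWith V n L θ) {φ : Inner} (hφ : φ.vars ⊆ V) :
    (θ.conjuncts.map (weight φ.str)).sum = sumEntailing V L φ := by
  rw [(h.conjuncts_perm.map _).sum_eq, List.map_append, List.sum_append, List.map_map, List.map_map]
  have h₁ : (L.map (weight φ.str ∘ fun q => Outer.cmp q.1 Cmp.ge q.2)).sum = 0 := by
    simp [Function.comp_def, weight]
  rw [h₁, add_zero, sumEntailing]
  refine congrArg List.sum (List.map_congr_left fun q hq => ?_)
  obtain ⟨X, hX⟩ := h.describes q hq
  have h₂ := evalInner_eq_true_iff (h.isTerm q hq) (h.vars_eq q hq)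
    (hX.symm ▸ Set.mem_singleton X : X ∈ truthSet V q.1) hφ
  simp only [Function.comp_apply, weight, hX, Set.singleton_subset_iff, ← h₂]
  cases evalInner q.1.str φ.str <;> simp

/-- The procedure finds the probability of `φ` as a numerator over the common denominator. -/
theorem num_mass (h : IsCompleteWith V n L θ) {φ : Inner} (hφ : φ.vars ⊆ V) :
    (num (mass θ.str φ.str).total : ℝ) =
      h.model.value (.pr φ) * num (denomStr θ.str) := by
  have hD : (num (denomStr θ.str) : ℝ) ≠ 0 := by exact_mod_cast (denomStr_pos h).ne'
  obtain ⟨s, h₁, -, h₃⟩ := exists_foldl_massStep φ.str θ (fun α hα => by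
    rw [h.conjuncts_perm.mem_iff] at hα
    simp only [List.mem_append, List.mem_map] at hα
    rcases hα with ⟨q, -, rfl⟩ | ⟨q, -, rfl⟩ <;> exact ⟨_, _, _, rfl⟩) ⟨[], [.bit true]⟩ (by simp)
  have h₄ : mass θ.str φ.str = s := by rw [mass, h₁]
  rw [← h₄, denom_mass, sum_weight h hφ] at h₃
  simp only [num_nil, Nat.cast_zero, zero_div, zero_add] at h₃
  exact (div_eq_iff hD).1 h₃

theorem cast_tsub (a b : ℕ) : ((a - b : ℕ) : ℝ) = max 0 ((a : ℝ) - b) := by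
  rcases le_total b a with h | h
  · rw [Nat.cast_sub h, max_eq_right]
    exact sub_nonneg.2 (by exact_mod_cast h)
  · rw [Nat.sub_eq_zero_of_le h, Nat.cast_zero, max_eq_left]
    exact sub_nonpos.2 (by exact_mod_cast h)

theorem cmpStr_eq_true_iff (d : Cmp) (x y : List Sym) :
    cmpStr d x y = true ↔ d.Holds (num x : ℝ) (num y : ℝ) := by
  cases d <;>
    simp [cmpStr, Cmp.Holds, isZeroStr_eq, Nat.sub_eq_zero_iff_le]

theorem max_min_mul {D : ℝ} (hD : 0 ≤ D) (a b : ℝ) :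
    max a b * D = max (a * D) (b * D) ∧ min a b * D = min (a * D) (b * D) :=
  ⟨max_mul_of_nonneg _ _ hD, min_mul_of_nonneg _ _ hD⟩

/-- Truncated subtraction from `D` twice cuts off at `D`. -/
theorem cast_tsub_tsub (D a : ℕ) : ((D - (D - a) : ℕ) : ℝ) = min (D : ℝ) a := by
  rcases le_total D a with h | h
  · rw [Nat.sub_eq_zero_of_le h, Nat.sub_zero, min_eq_left (by exact_mod_cast h)]
  · rw [Nat.sub_sub_self h, min_eq_right (by exact_mod_cast h)]

/-- Evaluating an outer formula pushes its value, over the common denominator. -/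
theorem exists_outerScan (h : IsCompleteWith V n L θ) (α : Outer) (hα : α.vars ⊆ V)
    (s : OuterEval) : ∃ x, outerScan θ.str (denomStr θ.str) α.str (.start, s) =
      (.start, { s with vals := x :: s.vals }) ∧
      (num x : ℝ) = h.model.value α * num (denomStr θ.str) := by
  have hpos := denomStr_pos h
  have hmass := fun (φ : Inner) (hφ : φ.vars ⊆ V) => num_mass h hφ
  have hpas := passive_outerStep θ.str (denomStr θ.str)
  generalize hD : denomStr θ.str = D at hpos hmass hpas
  have hposR : (0 : ℝ) < num D := by exact_mod_cast hpos
  have hicc := h.model.value_mem_Icc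
  unfold outerScan
  induction α generalizing s with
  | pr φ =>
    rw [foldl_scanStep_pr hpas]
    exact ⟨_, rfl, hmass φ hα⟩
  | cmp φ d c =>
    rw [foldl_scanStep_cmp hpas]
    refine ⟨_, rfl, ?_⟩
    have hd : (0 : ℝ) < (c : ℚ).den := by exact_mod_cast (c : ℚ).den_pos
    have h₁ : cmpStr d (mulStr (natStr (c : ℚ).den) (mass θ.str φ.str).total)
        (mulStr (natStr (c : ℚ).num.toNat) D) = true ↔
        d.Holds (h.model.μ (truthSet V φ)) ((c : ℚ) : ℝ) := by
      have h₂ := hmass φ hα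
      rw [Model.value] at h₂
      rw [cmpStr_eq_true_iff, num_mulStr, num_mulStr, num_natStr, num_natStr]
      push_cast
      rw [h₂, const_eq_div]
      generalize h.model.μ (truthSet V φ) = m
      have e₁ : ((c : ℚ).den : ℝ) * (m * num D) = m * ((c : ℚ).den * num D) := by ring
      have e₂ : ((c : ℚ).num.toNat : ℝ) * num D =
          ((c : ℚ).num.toNat : ℝ) / (c : ℚ).den * ((c : ℚ).den * num D) := by field_simp
      have hp : (0 : ℝ) < (c : ℚ).den * num D := mul_pos hd hposR
      rw [e₁, e₂]
      cases d
      · exact mul_le_mul_iff_left₀ hp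
      · exact mul_lt_mul_iff_left₀ hp
      · exact mul_lt_mul_iff_left₀ hp
      · exact mul_le_mul_iff_left₀ hp
    simp only [Model.value, ← h₁]
    cases cmpStr d (mulStr (natStr (c : ℚ).den) (mass θ.str φ.str).total)
        (mulStr (natStr (c : ℚ).num.toNat) D) <;> simp
  | neg α ih =>
    obtain ⟨x, hx, e⟩ := ih hα s
    refine ⟨subStr D x, ?_, ?_⟩
    · simp only [Outer.str, List.foldl_append, hx]
      rfl
    · rw [num_subStr, Model.value, cast_tsub, e, max_eq_right]
      · ring
      · nlinarith [(hicc α).2]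
  | delta α ih =>
    obtain ⟨x, hx, e⟩ := ih hα s
    refine ⟨bif isZeroStr (subStr D x) then D else [], ?_, ?_⟩
    · simp only [Outer.str, List.foldl_append, hx]
      rfl
    · have h₁ : isZeroStr (subStr D x) = true ↔ h.model.value α = 1 := by
        rw [isZeroStr_eq, num_subStr, decide_eq_true_iff, Nat.sub_eq_zero_iff_le,
          ← Nat.cast_le (α := ℝ), e]
        constructor
        · intro hle
          refine le_antisymm (hicc α).2 ?_
          nlinarith
        · intro h1
          rw [h1, one_mul]
      simp only [Model.value, ← h₁]
      cases isZeroStr (subStr D x) <;> simp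
  | odot α β ih ih' =>
    obtain ⟨x, hx, e⟩ := ih (Finset.union_subset_left hα) s
    obtain ⟨y, hy, e'⟩ := ih' (Finset.union_subset_right hα) { s with vals := x :: s.vals }
    refine ⟨subStr (addStr x y) D, ?_, ?_⟩
    · simp only [Outer.str, List.foldl_append, hx, hy]
      rfl
    · rw [num_subStr, num_addStr, cast_tsub, Model.value, (max_min_mul hposR.le _ _).1]
      push_cast
      rw [e, e']
      congr 1 <;> ring
  | oplus α β ih ih' =>
    obtain ⟨x, hx, e⟩ := ih (Finset.union_subset_left hα) s
    obtain ⟨y, hy, e'⟩ := ih' (Finset.union_subset_right hα) { s with vals := x :: s.vals }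
    refine ⟨subStr D (subStr D (addStr x y)), ?_, ?_⟩
    · simp only [Outer.str, List.foldl_append, hx, hy]
      rfl
    · rw [num_subStr, num_subStr, num_addStr, cast_tsub_tsub, Model.value,
        (max_min_mul hposR.le _ _).2]
      push_cast
      rw [e, e']
      congr 1 <;> ring
  | imp α β ih ih' =>
    obtain ⟨x, hx, e⟩ := ih (Finset.union_subset_left hα) s
    obtain ⟨y, hy, e'⟩ := ih' (Finset.union_subset_right hα) { s with vals := x :: s.vals }
    refine ⟨subStr D (subStr x y), ?_, ?_⟩
    · simp only [Outer.str, List.foldl_append, hx, hy]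
      rfl
    · have hα₁ := hicc α
      have hβ₁ := hicc β
      have hle : num x ≤ num D := by
        rw [← Nat.cast_le (α := ℝ), e]
        nlinarith [hα₁.2]
      rw [num_subStr, num_subStr, Nat.cast_sub ((Nat.sub_le _ _).trans hle), cast_tsub,
        Model.value, (max_min_mul hposR.le _ _).2, e, e']
      rcases le_total (h.model.value α) (h.model.value β) with hab | hab
      · rw [max_eq_left (by nlinarith), min_eq_left (by nlinarith)]
        ring
      · rw [max_eq_right (by nlinarith), min_eq_right (by nlinarith)]
        ring

/-- A formula closed by a comma is tested for the value `1`, and its value is removed. -/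
theorem outerScan_comma (h : IsCompleteWith V n L θ) (α : Outer) (hα : α.vars ⊆ V) (b : Bool)
    (v : List (List Sym)) : outerScan θ.str (denomStr θ.str) (α.str ++ [.comma]) (.start, ⟨b, v⟩) =
      (.start, ⟨decide (h.model.value α = 1) && b, v⟩) := by
  obtain ⟨x, hx, e⟩ := exists_outerScan h α hα ⟨b, v⟩
  have hposR : (0 : ℝ) < num (denomStr θ.str) := by exact_mod_cast denomStr_pos h
  rw [outerScan] at hx ⊢
  rw [List.foldl_append, hx]
  have h₁ : isZeroStr (subStr (denomStr θ.str) x) = decide (h.model.value α = 1) := by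
    rw [isZeroStr_eq, num_subStr, decide_eq_decide, Nat.sub_eq_zero_iff_le,
      ← Nat.cast_le (α := ℝ), e]
    constructor
    · intro hle
      refine le_antisymm (h.model.value_mem_Icc α).2 ?_
      nlinarith
    · intro h1
      rw [h1, one_mul]
  rw [← h₁]
  rfl

theorem outerScan_theory (h : IsCompleteWith V n L θ) (Γ : List Outer) (hΓ : ∀ γ ∈ Γ, γ.vars ⊆ V)
    (b : Bool) (v : List (List Sym)) : outerScan θ.str (denomStr θ.str)
      (Γ.flatMap fun γ => γ.str ++ [.comma]) (.start, ⟨b, v⟩) =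
      (.start, ⟨decide (∀ γ ∈ Γ, h.model.value γ = 1) && b, v⟩) := by
  induction Γ generalizing b with
  | nil => simp [outerScan]
  | cons γ Γ ih =>
    have h₁ := outerScan_comma h γ (hΓ γ (by simp)) b v
    have h₂ := ih (fun γ hγ => hΓ γ (by simp [hγ])) (decide (h.model.value γ = 1) && b)
    rw [outerScan] at h₁ h₂ ⊢
    rw [List.flatMap_cons, List.foldl_append, h₁, h₂]
    simp only [List.forall_mem_cons, Bool.decide_and]
    rw [← Bool.and_assoc, Bool.and_comm (decide (∀ γ ∈ Γ, h.model.value γ = 1))]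

end Verdict

/-- The procedure gives the right answer, and leaves no value behind. -/
theorem verdict_eq (I : Input) :
    verdict (I.problem.theory.flatMap fun γ => γ.str ++ [.comma]) I.problem.observation.str
      I.candidate.str = ⟨I.answer, []⟩ := by
  obtain ⟨L, h⟩ := I.complete
  have hsub : ∀ γ ∈ I.problem.observation :: I.problem.theory, γ.vars ⊆ I.problem.vars :=
    fun γ hγ => (outerVars_le hγ).trans Finset.subset_union_left
  have h₁ := outerScan_theory h I.problem.theory (fun γ hγ => hsub γ (by simp [hγ])) true []
  have h₂ := outerScan_comma h I.problem.observation (hsub _ (by simp))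
    (decide (∀ γ ∈ I.problem.theory, h.model.value γ = 1) && true) []
  rw [verdict]
  rw [outerScan] at h₁ h₂ ⊢
  rw [List.foldl_append, h₁, h₂]
  have h₃ : I.answer = (decide (h.model.value I.problem.observation = 1) &&
      (decide (∀ γ ∈ I.problem.theory, h.model.value γ = 1) && true)) := by
    rw [Input.answer, Bool.and_true, ← Bool.decide_and, decide_eq_decide, isFullSolution_iff h,
      and_comm]
  rw [h₃]

/-- The answer is a feasible transformation of the input. -/
theorem feasible_answer :
    Feasible Input.strings fun I => [bif I.answer then [Sym.bit true] else []] := by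
  refine Feasible.popBit (b := Input.answer) (r := fun _ => [])
    (g := fun b _ => [bif b then [Sym.bit true] else []]) ?_ fun b => ?_
  · exact (feasible_verdict _ _ _ _ _).congr fun I => by rw [verdict_eq]
  · cases b
    · exact (Feasible.refl _).nil
    · exact (Feasible.refl _).pushBit true

end FPAbduction

theorem mainTheorem2 :
    (∀ (P : FPAbduction.Problem) (θ : FPAbduction.Outer)
        (L : List (FPAbduction.Inner × FPAbduction.Const)),
      FPAbduction.IsCompleteWith P.vars P.n L θ →
        (∃! M : FPAbduction.Model P.vars, M.value θ = 1) ∧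
        ∀ M : FPAbduction.Model P.vars, M.value θ = 1 →
          ∀ φ : FPAbduction.Inner, φ.vars ⊆ P.vars →
            M.value (FPAbduction.Outer.pr φ) = FPAbduction.sumEntailing P.vars L φ) ∧
    Nonempty (Turing.TM2ComputableInPolyTime FPAbduction.Input.encode Computability.encodeBool
      FPAbduction.Input.answer) := by
  refine ⟨fun P θ L h => ⟨⟨h.model, h.value_model, fun M hM => h.eq_model hM⟩, ?_⟩, ?_⟩
  · intro M hM φ _
    obtain rfl := h.eq_model hM
    rfl
  · exact FPAbduction.feasible_answer.computableInPolyTime (n := 5) (fun _ => rfl)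
      FPAbduction.letterEquiv FPAbduction.Input.encode_eq (.bit true)
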